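/- **Theorem (Optimal query complexity of channel learning, lower bound).** There are universal constants $\varepsilon_0>0$ and $c>0$ such that the following holds. Let $d_A\ge 1$, $d_B\ge 2$, $r$ and $n$ be non-negative integers with $d_A\le r d_B$ and $r\le d_Ad_B$ (the numbers $r$ that are Choi ranks of channels with these dimensions), and let $0<\varepsilon\le\varepsilon_0$. Suppose that a quantum algorithm makes $n$ queries to an unknown quantum channel $\Phi:\mathcal L(\mathbb C^{d_A})\to\mathcal L(\mathbb C^{d_B})$, outputs a channel $\hat\Phi$, and satisfies $\Pr\big[\|\hat\Phi-\Phi\|_\diamond\le\varepsilon\big]\ge 2/3$ for every channel $\Phi$ of Choi rank at most $r$. Then $$n\ \ge\ c\, r\, d_A d_B .$$ Here the algorithm may use its queries in an arbitrary way, including an indefinite causal order: it is any $n$-slot tester, i.e. a measure $T$ on a measurable space of outcomes whose values are positive semidefinite operators on the $n$ pairs of input and output systems of the queries and whose total mass satisfies $\operatorname{Tr}\big[T(\Omega)\,(J_{C_1}\otimes\cdots\otimes J_{C_n})\big]=1$ for all channels $C_1,\dots,C_n$ between these systems, where $J_C$ is the Choi operator of $C$; if every query is answered by the channel $C$, the outcome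 lies in $E$ with probability $\operatorname{Tr}\big[T(E)\,J_C^{\otimes n}\big]$, and $\hat\Phi$ is a measurable function of the outcome. In each query the algorithm may choose to use $\Phi$, its inverse, a controlled version of $\Phi$, or a controlled version of its inverse: the input system of a query is the direct sum of the input systems of these four channels, the output system is the direct sum of their output systems, and the query is answered by the direct sum of the four channels. The inverse of $\Phi$ is a channel $\Psi$ with $\Psi\circ\Phi=\mathrm{Id}$ and $\Phi\circ\Psi=\mathrm{Id}$; if none exists, the two kinds of queries that involve it are answered by fixed channels, which do not depend on $\Phi$. A controlled version of a channel $\Phi$ from $\mathcal L(\mathcal H_A)$ to $\mathcal L(\mathcal H_B)$ is a channel from $\mathcal L(\mathcal H_A\oplus\mathcal H_A)$ to $\mathcal L(\mathcal H_A\oplus\mathcal H_B)$ that acts as $X\oplus 0\mapsto X\oplus 0$ and $0\oplus X\mapsto 0\oplus\Phi(X)$; the bound holds for every way of fixing, for each $\Phi$, the controlled versions that the queries use. -/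

import Mathlib

open scoped ComplexOrder ENNReal

noncomputable section

namespace ChannelLearning

/-! ### Quantum channels

The space of operators on a finite-dimensional Hilbert space with orthonormal basis indexed by `a`
is `Matrix a a ℂ`; a direct sum of Hilbert spaces is indexed by `a ⊕ b` and a tensor product
by `a × b`. -/

/-- Linear maps `L(H_A) → L(H_B)`. -/
abbrev SuperOp (a b : Type) : Type := Matrix a a ℂ →ₗ[ℂ] Matrix b b ℂ

/-- The operator `(Φ ⊗ id_k)(X)`, for an operator `X` on `H_A ⊗ ℂᵏ`. -/
def ampliate {a b : Type} (Φ : SuperOp a b) (k : ℕ)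
    (X : Matrix (a × Fin k) (a × Fin k) ℂ) : Matrix (b × Fin k) (b × Fin k) ℂ :=
  Matrix.of fun p q => Φ (Matrix.of fun i j => X (i, p.2) (j, q.2)) p.1 q.1

/-- A quantum channel: a completely positive and trace-preserving linear map. -/
structure IsChannel {a b : Type} [Fintype a] [Fintype b] (Φ : SuperOp a b) : Prop where
  completely_positive : ∀ (k : ℕ) (X : Matrix (a × Fin k) (a × Fin k) ℂ),
    X.PosSemidef → (ampliate Φ k X).PosSemidef
  trace_preserving : ∀ X : Matrix a a ℂ, (Φ X).trace = X.trace

/-- The Choi operator `∑ i j, |i⟩⟨j| ⊗ Φ(|i⟩⟨j|)` on `H_A ⊗ H_B`. -/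
def choi {a b : Type} [DecidableEq a] (Φ : SuperOp a b) : Matrix (a × b) (a × b) ℂ :=
  Matrix.of fun p q => Φ (Matrix.single p.1 q.1 1) p.2 q.2

/-- The Choi rank of a linear map. -/
def choiRank {a b : Type} [DecidableEq a] [Fintype a] [Fintype b] (Φ : SuperOp a b) : ℕ :=
  (choi Φ).rank

/-- The trace norm of an operator: the sum of its singular values. -/
def traceNorm {a : Type} [Fintype a] [DecidableEq a] (X : Matrix a a ℂ) : ℝ :=
  ∑ i, Real.sqrt ((Matrix.isHermitian_conjTranspose_mul_self X).eigenvalues i)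

/-- The diamond norm `sup_k sup { ‖(Λ ⊗ id_k)(X)‖₁ : ‖X‖₁ ≤ 1 }`. -/
def diamondNorm {a b : Type} [Fintype a] [DecidableEq a] [Fintype b] [DecidableEq b]
    (Λ : SuperOp a b) : ℝ≥0∞ :=
  ⨆ (k : ℕ) (X : Matrix (a × Fin k) (a × Fin k) ℂ) (_ : traceNorm X ≤ 1),
    ENNReal.ofReal (traceNorm (ampliate Λ k X))

/-! ### Versions of a channel that can be queried -/

/-- `Ψ` is the inverse of the channel `Φ`: a channel that is inverse to it on both sides. -/
structure IsInverse {a b : Type} [Fintype a] [Fintype b]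
    (Φ : SuperOp a b) (Ψ : SuperOp b a) : Prop where
  channel : IsChannel Ψ
  left_inv : Ψ ∘ₗ Φ = LinearMap.id
  right_inv : Φ ∘ₗ Ψ = LinearMap.id

/-- `Ψ` is a controlled version of `Φ : L(H_A) → L(H_B)`: a channel from
`|0⟩ ⊗ H_A ⊕ |1⟩ ⊗ H_A` to `|0⟩ ⊗ H_A ⊕ |1⟩ ⊗ H_B` that leaves the system untouched when the control
is in the state `|0⟩` and applies `Φ` when it is in the state `|1⟩`. Nothing else is required of its
action on superpositions of the control states; when `Φ(X) = U X U†` with `U` unitary, the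
channel `X ↦ C X C†` with `C = 1 ⊕ e^{iθ} U` is such a version for every phase `θ`. -/
structure IsControlled {a b : Type} [Fintype a] [Fintype b]
    (Φ : SuperOp a b) (Ψ : SuperOp (a ⊕ a) (a ⊕ b)) : Prop where
  channel : IsChannel Ψ
  off : ∀ X : Matrix a a ℂ, Ψ (Matrix.fromBlocks X 0 0 0) = Matrix.fromBlocks X 0 0 0
  on : ∀ X : Matrix a a ℂ, Ψ (Matrix.fromBlocks 0 0 0 X) = Matrix.fromBlocks 0 0 0 (Φ X)

/-- The direct sum of two maps: it measures which summand the system is in,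
and applies the corresponding map. -/
def directSum {a b c d : Type} (Φ : SuperOp a b) (Ψ : SuperOp c d) :
    SuperOp (a ⊕ c) (b ⊕ d) where
  toFun X := Matrix.fromBlocks (Φ X.toBlocks₁₁) 0 0 (Ψ X.toBlocks₂₂)
  map_add' X Y := by
    have h₁ : (X + Y).toBlocks₁₁ = X.toBlocks₁₁ + Y.toBlocks₁₁ := rfl
    have h₂ : (X + Y).toBlocks₂₂ = X.toBlocks₂₂ + Y.toBlocks₂₂ := rfl
    rw [h₁, h₂, map_add, map_add, Matrix.fromBlocks_add, add_zero, add_zero]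
  map_smul' t X := by
    have h₁ : (t • X).toBlocks₁₁ = t • X.toBlocks₁₁ := rfl
    have h₂ : (t • X).toBlocks₂₂ = t • X.toBlocks₂₂ := rfl
    rw [h₁, h₂, map_smul, map_smul, RingHom.id_apply, Matrix.fromBlocks_smul, smul_zero, smul_zero]

/-- What the four kinds of queries to a channel `Φ` with input dimension `dA` and output dimension
`dB` are answered with: `Φ` itself, the inverse of `Φ`, a controlled version of `Φ`, and a
controlled version of the inverse. The controlled versions are not unique; a model fixes one for
each channel, in an arbitrary way. When `Φ` has no inverse, the two queries that involve it are
answered with fixed channels, which do not depend on `Φ`. -/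
structure QueryModel (dA dB : ℕ) where
  inv : SuperOp (Fin dA) (Fin dB) → SuperOp (Fin dB) (Fin dA)
  ctrl : SuperOp (Fin dA) (Fin dB) → SuperOp (Fin dA ⊕ Fin dA) (Fin dA ⊕ Fin dB)
  ctrlInv : SuperOp (Fin dA) (Fin dB) → SuperOp (Fin dB ⊕ Fin dB) (Fin dB ⊕ Fin dA)
  noInv : SuperOp (Fin dB) (Fin dA)
  noCtrlInv : SuperOp (Fin dB ⊕ Fin dB) (Fin dB ⊕ Fin dA)
  noInv_channel : IsChannel noInv
  noCtrlInv_channel : IsChannel noCtrlInv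
  ctrl_spec : ∀ Φ, IsChannel Φ → IsControlled Φ (ctrl Φ)
  inv_spec : ∀ Φ, IsChannel Φ → (∃ Ψ, IsInverse Φ Ψ) →
    IsInverse Φ (inv Φ) ∧ IsControlled (inv Φ) (ctrlInv Φ)
  noInv_spec : ∀ Φ, IsChannel Φ → (¬ ∃ Ψ, IsInverse Φ Ψ) →
    inv Φ = noInv ∧ ctrlInv Φ = noCtrlInv

/-- Input system of a query: the direct sum of the input systems of the four kinds. -/
abbrev QueryIn (dA dB : ℕ) : Type :=
  (Fin dA ⊕ Fin dB) ⊕ ((Fin dA ⊕ Fin dA) ⊕ (Fin dB ⊕ Fin dB))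

/-- Output system of a query: the direct sum of the output systems of the four kinds. -/
abbrev QueryOut (dA dB : ℕ) : Type :=
  (Fin dB ⊕ Fin dA) ⊕ ((Fin dA ⊕ Fin dB) ⊕ (Fin dB ⊕ Fin dA))

/-- One query: the summand in which the input is placed selects the kind of the query, so
that an algorithm may choose the kinds of its queries adaptively. -/
def QueryModel.query {dA dB : ℕ} (Q : QueryModel dA dB) (Φ : SuperOp (Fin dA) (Fin dB)) :
    SuperOp (QueryIn dA dB) (QueryOut dA dB) :=
  directSum (directSum Φ (Q.inv Φ)) (directSum (Q.ctrl Φ) (Q.ctrlInv Φ))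

/-! ### Algorithms -/

/-- The tensor product of the Choi operators of `n` maps. -/
def choiTensor {n : ℕ} {a b : Type} [DecidableEq a] (C : Fin n → SuperOp a b) :
    Matrix (Fin n → a × b) (Fin n → a × b) ℂ :=
  Matrix.of fun p q => ∏ j, choi (C j) (p j) (q j)

/-- A general `n`-slot tester: the most general way to plug `n` channels, each used once and
possibly in an indefinite causal order, into a quantum experiment with outcomes in `Ω`. It is a
measure on `Ω` whose values are positive semidefinite operators on the `n` pairs of
input and output systems, such that the generalized Born rule gives total probability one for all
choices of the `n` channels (that is, its total mass is a process matrix). -/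
structure Tester (n : ℕ) (a b : Type) [Fintype a] [DecidableEq a] [Fintype b] [DecidableEq b]
    (Ω : Type*) [MeasurableSpace Ω] where
  op : MeasureTheory.VectorMeasure Ω (Matrix (Fin n → a × b) (Fin n → a × b) ℂ)
  posSemidef : ∀ E, (op E).PosSemidef
  normalized : ∀ C : Fin n → SuperOp a b, (∀ j, IsChannel (C j)) →
    (op Set.univ * choiTensor C).trace = 1

/-- The probability that the outcome lies in `E` when all slots hold the same channel `C`. -/
def Tester.prob {n : ℕ} {a b : Type} [Fintype a] [DecidableEq a] [Fintype b] [DecidableEq b]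
    {Ω : Type*} [MeasurableSpace Ω] (T : Tester n a b Ω) (C : SuperOp a b) (E : Set Ω) : ℝ :=
  (T.op E * choiTensor fun _ : Fin n => C).trace.re

/-- An algorithm that makes `n` queries to an unknown channel and outputs (the description of) a
channel, which is a measurable function of the outcome `ω` of its experiment. -/
structure LearningAlgorithm (n dA dB : ℕ) (Ω : Type*) [MeasurableSpace Ω] where
  tester : Tester n (QueryIn dA dB) (QueryOut dA dB) Ω
  estimate : Ω → SuperOp (Fin dA) (Fin dB)
  estimate_channel : ∀ ω, IsChannel (estimate ω)
  estimate_measurable : ∀ (Φ : SuperOp (Fin dA) (Fin dB)) (s : ℝ≥0∞),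
    MeasurableSet {ω | diamondNorm (estimate ω - Φ) ≤ s}

/-- The algorithm learns every channel of Choi rank at most `r` to diamond-norm error `ε` with
success probability at least `2/3`. -/
def LearningAlgorithm.Learns {n dA dB : ℕ} {Ω : Type*} [MeasurableSpace Ω]
    (A : LearningAlgorithm n dA dB Ω) (Q : QueryModel dA dB) (r : ℕ) (ε : ℝ) : Prop :=
  ∀ Φ : SuperOp (Fin dA) (Fin dB), IsChannel Φ → choiRank Φ ≤ r →
    2 / 3 ≤ A.tester.prob (Q.query Φ)
      {ω | diamondNorm (A.estimate ω - Φ) ≤ ENNReal.ofReal ε}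

end ChannelLearning

end

/-! The lower bound compares two counts. There is a packing of `exp(c r dA dB)` channels of Choi
rank at most `r`, no two of which can be within `ε` of one common channel. A successful learner
identifies each member with probability at least 2/3, since the events "the estimate is `ε`-close to
`Φ x`" are disjoint. On the other hand, few queries cannot identify that many channels.

The upper count (`Tester.sum_prob_le`) rests on linearity. The Choi operator of a full query, with
inverse and controlled versions included, has a purification that is linear in a vector `u` of `M =
O(r dA dB)` complex parameters (`QueryModel.linearlyPurified`): an inverse has Choi rank one, and a
controlled version costs only one extra Kraus operator. So the purification of `n` copies is linear
in the degree-`n` monomials of `u`, which span a space of dimension `D = (M + n - 1).choose n`.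
Vectors in dimension `D` have total success probability at most `D ^ 2` (`sum_quadForm_le`). The
proof evaluates the tester only on copies of the given channels, where its normalization is
available, so causal order plays no role. If `n` is a small multiple of `r dA dB`, then `D ^ 2` is
smaller than 2/3 of the packing (`le_of_choose_sq`).

The packing (`exists_channel_packing`) perturbs one isometry `V` whose reshaping, with environment
and input exchanged, is also proportional to a partial isometry. The perturbations `K` are small
multiples of sign arrays, placed in output levels that `V` does not use. Most sign arrays have small
operator norm in both matrix shapes: one shape makes `V + 2K` nearly an isometry, the other bounds
the observable `V (K - K')†` formed from the reshaped matrices. On a maximally entangled input this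
observable sees the difference of two channels at first order in the size `τ` of the perturbation,
while all errors are of order `τ ^ 2`, so a fixed small `τ` gives a constant separation. -/

namespace ChannelLearning

/-! ### Sign tensors -/

section Signs

open Finset

/-- The sign encoded by a Boolean. -/
def sgn (b : Bool) : ℝ := if b then 1 else -1

lemma sgn_mul_self (b : Bool) : sgn b * sgn b = 1 := by
  cases b <;> simp [sgn]

/-- The sum factorizes over the coordinates into factors `2 cosh (a i)`, and `cosh x ≤ exp (x ^ 2 /
2)`. -/
lemma sum_exp_signs_le {ι : Type*} [Fintype ι] [DecidableEq ι] (a : ι → ℝ) :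
    ∑ s : ι → Bool, Real.exp (∑ i, a i * sgn (s i)) ≤
      2 ^ Fintype.card ι * Real.exp ((∑ i, a i ^ 2) / 2) := by
  have h1 : ∑ s : ι → Bool, Real.exp (∑ i, a i * sgn (s i)) = ∏ i, (2 * Real.cosh (a i)) := by
    have : ∀ i, 2 * Real.cosh (a i) = ∑ b : Bool, Real.exp (a i * sgn b) := by
      intro i
      rw [Fintype.sum_bool, Real.cosh_eq]
      simp only [sgn, if_true, mul_one, Bool.false_eq_true, if_false, mul_neg]
      ring
    simp_rw [this, Finset.prod_univ_sum, Fintype.piFinset_univ, Real.exp_sum]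
  rw [h1, Finset.prod_mul_distrib, Finset.sum_div, Real.exp_sum]
  simp only [prod_const, card_univ]
  gcongr with i
  exact Real.cosh_le_exp_half_sq _

/-- Hoeffding's inequality for sums of independent signs, as a count. -/
lemma card_signs_le {ι : Type*} [Fintype ι] [DecidableEq ι] (a : ι → ℝ) {t v : ℝ} (ht : 0 ≤ t)
    (hv : 0 < v) (ha : ∑ i, a i ^ 2 ≤ v) :
    (#{s : ι → Bool | t ≤ ∑ i, a i * sgn (s i)} : ℝ) ≤
      2 ^ Fintype.card ι * Real.exp (-(t ^ 2 / (2 * v))) := by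
  -- Chernoff's method; `t / v` minimizes the exponent `-λ t + λ ^ 2 v / 2` over `λ`.
  have h := sum_exp_signs_le fun i => t / v * a i
  have h2 : (#{s : ι → Bool | t ≤ ∑ i, a i * sgn (s i)} : ℝ) * Real.exp (t / v * t) ≤
      ∑ s : ι → Bool, Real.exp (∑ i, t / v * a i * sgn (s i)) := by
    have h5 : ∀ s ∈ ({s : ι → Bool | t ≤ ∑ i, a i * sgn (s i)} : Finset _),
        Real.exp (t / v * t) ≤ Real.exp (∑ i, t / v * a i * sgn (s i)) := by
      intro s hs
      have hs' := (Finset.mem_filter.1 hs).2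
      simp_rw [mul_assoc, ← Finset.mul_sum]
      exact Real.exp_le_exp.2 (mul_le_mul_of_nonneg_left hs' (by positivity))
    rw [← nsmul_eq_mul]
    exact (Finset.card_nsmul_le_sum _ _ _ h5).trans (Finset.sum_le_sum_of_subset_of_nonneg
      (Finset.filter_subset _ _) fun _ _ _ => (Real.exp_pos _).le)
  have h3 : (∑ i, (t / v * a i) ^ 2) / 2 ≤ t ^ 2 / (2 * v) := by
    simp_rw [mul_pow, ← Finset.mul_sum]
    calc (t / v) ^ 2 * (∑ i, a i ^ 2) / 2 ≤ (t / v) ^ 2 * v / 2 := by gcongr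
      _ = t ^ 2 / (2 * v) := by field_simp
  have h4 := h2.trans (h.trans (mul_le_mul_of_nonneg_left (Real.exp_le_exp.2 h3) (by positivity)))
  rw [← le_div_iff₀ (Real.exp_pos _), mul_div_assoc, ← Real.exp_sub] at h4
  refine h4.trans_eq ?_
  congr 2
  field_simp
  ring

/-- A half-net of the unit ball of a finite-dimensional real space. -/
lemma exists_half_net (E : Type*) [NormedAddCommGroup E] [NormedSpace ℝ E]
    [FiniteDimensional ℝ E] :
    ∃ N : Finset E, N.card ≤ 5 ^ Module.finrank ℝ E ∧ (∀ c ∈ N, ‖c‖ ≤ 1) ∧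
      ∀ x : E, ‖x‖ ≤ 1 → ∃ c ∈ N, ‖x - c‖ ≤ 1 / 2 := by
  classical
  let P : ℕ → Prop := fun k => ∃ N : Finset E, N.card = k ∧ (∀ c ∈ N, ‖c‖ ≤ 1) ∧
    ∀ c ∈ N, ∀ d ∈ N, c ≠ d → 1 / 2 ≤ ‖c - d‖
  have hb : ∀ k, P k → k ≤ 5 ^ Module.finrank ℝ E := by
    rintro k ⟨N, rfl, h1, h2⟩
    -- `Besicovitch.card_le_of_separated` concerns 1-separated points in the ball of radius 2, hence
    -- the dilation by 2.
    have hinj : Function.Injective fun x : E => (2 : ℝ) • x := fun x y h =>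
      smul_right_injective E (two_ne_zero (α := ℝ)) h
    rw [← Finset.card_image_of_injective N hinj]
    apply Besicovitch.card_le_of_separated
    · intro c hc
      obtain ⟨x, hx, rfl⟩ := Finset.mem_image.1 hc
      have := h1 x hx
      simp only [norm_smul, Real.norm_ofNat]
      linarith
    · intro c hc d hd hcd
      obtain ⟨x, hx, rfl⟩ := Finset.mem_image.1 hc
      obtain ⟨y, hy, rfl⟩ := Finset.mem_image.1 hd
      have := h2 x hx y hy (fun h => hcd (by rw [h]))
      rw [← smul_sub, norm_smul, Real.norm_ofNat]
      linarith
  have h0 : P 0 := ⟨∅, by simp⟩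
  obtain ⟨N, hN, h1, h2⟩ := Nat.findGreatest_spec (P := P) (Nat.zero_le _) h0
  set k := Nat.findGreatest P (5 ^ Module.finrank ℝ E) with hk
  -- A separated set of maximal size is a net, because an uncovered point could be added to it.
  refine ⟨N, hN ▸ Nat.findGreatest_le _, h1, fun x hx => ?_⟩
  by_contra! hcon
  have hxN : x ∉ N := fun h => by
    have := hcon x h
    norm_num at this
  have hP : P (k + 1) := by
    refine ⟨insert x N, by rw [Finset.card_insert_of_notMem hxN, hN], ?_, ?_⟩
    · intro c hc
      rcases Finset.mem_insert.1 hc with rfl | hc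
      exacts [hx, h1 c hc]
    · intro c hc d hd hcd
      rcases Finset.mem_insert.1 hc with rfl | hc' <;> rcases Finset.mem_insert.1 hd with rfl | hd'
      · exact absurd rfl hcd
      · exact (hcon d hd').le
      · rw [norm_sub_rev]
        exact (hcon c hc').le
      · exact h2 c hc' d hd' hcd
  have := Nat.le_findGreatest (hb _ hP) hP
  omega

/-- Replacing the unit vector along `v` by a net point loses at most half of `‖v‖`. -/
lemma norm_le_of_net {E : Type*} [NormedAddCommGroup E] [InnerProductSpace ℝ E] {N : Finset E}
    (hN : ∀ x : E, ‖x‖ ≤ 1 → ∃ c ∈ N, ‖x - c‖ ≤ 1 / 2) {t : ℝ} {v : E}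
    (h : ∀ c ∈ N, inner ℝ c v ≤ t) : ‖v‖ ≤ 2 * t := by
  rcases eq_or_ne v 0 with rfl | hv
  · obtain ⟨c, hc, -⟩ := hN 0 (by simp)
    have := h c hc
    simp only [inner_zero_right] at this
    simpa using this
  have hv' : 0 < ‖v‖ := norm_pos_iff.2 hv
  obtain ⟨c, hc, hxc⟩ := hN (‖v‖⁻¹ • v) (by rw [norm_smul, norm_inv, norm_norm]; field_simp; rfl)
  have h1 : inner ℝ (‖v‖⁻¹ • v) v = ‖v‖ := by
    rw [inner_smul_left, real_inner_self_eq_norm_sq]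
    simp only [map_inv₀, conj_trivial]
    field_simp
  have h2 : inner ℝ (‖v‖⁻¹ • v - c) v ≤ 1 / 2 * ‖v‖ :=
    (real_inner_le_norm _ _).trans (by gcongr)
  rw [inner_sub_left, h1] at h2
  linarith [h c hc]

/-- Approximating unit vectors by net points gives `‖L‖ ≤ t + ‖L‖ / 2`. -/
lemma opNorm_le_of_net {E F : Type*} [NormedAddCommGroup E] [NormedSpace ℝ E]
    [NormedAddCommGroup F] [NormedSpace ℝ F] {N : Finset E}
    (hN : ∀ x : E, ‖x‖ ≤ 1 → ∃ c ∈ N, ‖x - c‖ ≤ 1 / 2) {t : ℝ} {L : E →L[ℝ] F}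
    (h : ∀ c ∈ N, ‖L c‖ ≤ t) : ‖L‖ ≤ 2 * t := by
  have ht : 0 ≤ t := by
    obtain ⟨c, hc, -⟩ := hN 0 (by simp)
    exact (norm_nonneg _).trans (h c hc)
  have : ‖L‖ ≤ t + 1 / 2 * ‖L‖ := by
    refine L.opNorm_le_of_unit_norm (by positivity) fun x hx => ?_
    obtain ⟨c, hc, hxc⟩ := hN x hx.le
    calc ‖L x‖ = ‖L c + L (x - c)‖ := by rw [← map_add]; congr 2; abel
      _ ≤ ‖L c‖ + ‖L (x - c)‖ := norm_add_le _ _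
      _ ≤ t + ‖L‖ * (1 / 2) := by
        gcongr
        · exact h c hc
        · exact (L.le_opNorm _).trans (by gcongr)
      _ = _ := by ring
  linarith

/-- `c` bounds the operator norm of the real matrix `M`. -/
def OpBound {p q : Type*} [Fintype p] [Fintype q] (M : Matrix p q ℝ) (c : ℝ) : Prop :=
  ∀ y : q → ℝ, ∑ i, (∑ j, M i j * y j) ^ 2 ≤ c ^ 2 * ∑ j, y j ^ 2

/-- All but few of the sign matrices have a small operator norm. -/
lemma card_signMatrix_le {p q ι : Type*} [Fintype p] [Fintype q] [Fintype ι] [DecidableEq ι]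
    (e : p × q ≃ ι) (h0 : 2 ≤ Fintype.card p + Fintype.card q) {w : ℝ}
    (hw : (Fintype.card p + Fintype.card q : ℝ) ≤ 2 * w) :
    ∃ B : Finset (ι → Bool), (B.card : ℝ) ≤ 2 ^ Fintype.card ι * (1 / 20) ∧
      ∀ s ∉ B, OpBound (Matrix.of fun i j => sgn (s (e (i, j)))) (16 * Real.sqrt w) := by
  classical
  obtain ⟨N1, hN1, hN1b, hN1n⟩ := exists_half_net (EuclideanSpace ℝ p)
  obtain ⟨N2, hN2, hN2b, hN2n⟩ := exists_half_net (EuclideanSpace ℝ q)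
  rw [finrank_euclideanSpace] at hN1 hN2
  -- Each pair of net points excludes a fraction `exp(-t ^ 2 / 2) = exp(-8 w) ≤ exp(-4 (|p| + |q|))`
  -- of the sign vectors, which beats the at most `5 ^ (|p| + |q|)` pairs. The two nets cost a
  -- factor 2 each, so the final norm bound is `4 t = 16 √w`.
  set t : ℝ := 4 * Real.sqrt w with ht
  have hw1 : 1 ≤ w := by
    have : (2 : ℝ) ≤ Fintype.card p + Fintype.card q := by exact_mod_cast h0
    linarith
  have htn : 0 ≤ t := by positivity
  have ht2 : t ^ 2 = 16 * w := by rw [ht, mul_pow, Real.sq_sqrt (by linarith)]; norm_num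
  let Bd : EuclideanSpace ℝ p × EuclideanSpace ℝ q → Finset (ι → Bool) := fun xy =>
    {s | t ≤ ∑ i, (xy.1 (e.symm i).1 * xy.2 (e.symm i).2) * sgn (s i)}
  refine ⟨(N1 ×ˢ N2).biUnion Bd, ?_, ?_⟩
  · have hB : ∀ xy ∈ N1 ×ˢ N2, ((Bd xy).card : ℝ) ≤
        2 ^ Fintype.card ι * Real.exp (-(t ^ 2 / (2 * 1))) := by
      intro xy hxy
      rw [Finset.mem_product] at hxy
      apply card_signs_le _ htn one_pos
      have h1 := hN1b _ hxy.1
      have h2 := hN2b _ hxy.2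
      have h1' : ∑ i, (xy.1 i) ^ 2 ≤ 1 := by
        rw [← EuclideanSpace.real_norm_sq_eq]
        exact pow_le_one₀ (norm_nonneg _) h1
      have h2' : ∑ i, (xy.2 i) ^ 2 ≤ 1 := by
        rw [← EuclideanSpace.real_norm_sq_eq]
        exact pow_le_one₀ (norm_nonneg _) h2
      rw [← Equiv.sum_comp e]
      simp only [Equiv.symm_apply_apply, mul_pow]
      rw [Fintype.sum_prod_type]
      simp only [← Finset.mul_sum, ← Finset.sum_mul]
      exact mul_le_one₀ h1' (Finset.sum_nonneg fun _ _ => sq_nonneg _) h2'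
    have hc : (((N1 ×ˢ N2).biUnion Bd).card : ℝ) ≤ ∑ xy ∈ N1 ×ˢ N2, ((Bd xy).card : ℝ) := by
      exact_mod_cast Finset.card_biUnion_le
    refine hc.trans ((Finset.sum_le_sum hB).trans ?_)
    rw [Finset.sum_const, nsmul_eq_mul, Finset.card_product, mul_left_comm]
    gcongr
    have h5 : ((N1.card * N2.card : ℕ) : ℝ) ≤ 5 ^ (Fintype.card p + Fintype.card q) := by
      rw [pow_add]
      exact_mod_cast Nat.mul_le_mul hN1 hN2
    have h6 : Real.exp (-(t ^ 2 / (2 * 1))) ≤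
        Real.exp (-4) ^ (Fintype.card p + Fintype.card q) := by
      rw [← Real.exp_nat_mul, ht2]
      gcongr
      push_cast
      linarith
    have h7 : (5 : ℝ) * Real.exp (-4) ≤ 1 / 10 := by
      rw [Real.exp_neg, ← div_eq_mul_inv, div_le_iff₀ (Real.exp_pos _)]
      have h8 : Real.exp 4 = Real.exp 1 ^ 4 := by rw [← Real.exp_nat_mul]; norm_num
      have h9 : (2.7 : ℝ) ≤ Real.exp 1 := by linarith [Real.exp_one_gt_d9]
      have : (2.7 : ℝ) ^ 4 ≤ Real.exp 1 ^ 4 := by gcongr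
      rw [h8]
      linarith
    calc _ ≤ 5 ^ (Fintype.card p + Fintype.card q) *
          Real.exp (-4) ^ (Fintype.card p + Fintype.card q) := by gcongr
      _ = (5 * Real.exp (-4)) ^ (Fintype.card p + Fintype.card q) := by rw [mul_pow]
      _ ≤ (1 / 10) ^ (Fintype.card p + Fintype.card q) := by gcongr
      _ ≤ (1 / 10 : ℝ) ^ 2 := pow_le_pow_of_le_one (by norm_num) (by norm_num) h0
      _ ≤ 1 / 20 := by norm_num
  · intro s hs y
    let M : Matrix p q ℝ := Matrix.of fun i j => sgn (s (e (i, j)))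
    let L : EuclideanSpace ℝ q →L[ℝ] EuclideanSpace ℝ p :=
      LinearMap.toContinuousLinearMap (Matrix.toEuclideanLin M)
    have hLapp : ∀ (z : EuclideanSpace ℝ q) i, L z i = ∑ j, M i j * z j := by
      intro z i
      simp [L, Matrix.toLpLin_apply, Matrix.mulVec, dotProduct]
    have hL : ‖L‖ ≤ 2 * (2 * t) := by
      refine opNorm_le_of_net hN2n fun z hz => norm_le_of_net hN1n fun x hx => ?_
      have : s ∉ Bd (x, z) := fun h => hs (Finset.mem_biUnion.2 ⟨_, Finset.mk_mem_product hx hz, h⟩)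
      simp only [Bd, Finset.mem_filter, Finset.mem_univ, true_and, not_le] at this
      refine le_of_eq_of_le ?_ this.le
      rw [← Equiv.sum_comp e, Fintype.sum_prod_type, PiLp.inner_apply]
      refine Finset.sum_congr rfl fun i _ => ?_
      simp only [hLapp, Equiv.symm_apply_apply, RCLike.inner_apply, conj_trivial, M,
        Matrix.of_apply, Finset.sum_mul]
      refine Finset.sum_congr rfl fun j _ => ?_
      ring
    have h1 := L.le_of_opNorm_le hL (WithLp.toLp 2 y)
    have h2 : ‖L (WithLp.toLp 2 y)‖ ^ 2 ≤ (2 * (2 * t) * ‖WithLp.toLp 2 y‖) ^ 2 := by gcongr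
    rw [mul_pow, EuclideanSpace.real_norm_sq_eq, EuclideanSpace.real_norm_sq_eq] at h2
    simp only [hLapp] at h2
    refine h2.trans_eq ?_
    congr 2
    rw [ht]
    ring

/-- A Gilbert–Varshamov bound inside a set that contains most of the sign vectors. -/
lemma exists_separated_signs {ι : Type*} [Fintype ι] [DecidableEq ι] (hι : 0 < Fintype.card ι)
    (S : Finset (ι → Bool)) (hS : 2 ^ Fintype.card ι * (9 / 10 : ℝ) ≤ S.card) :
    ∃ T ⊆ S, Real.exp (Fintype.card ι / 8) ≤ (T.card : ℝ) ∧
      ∀ s ∈ T, ∀ s' ∈ T, s ≠ s' →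
        (Fintype.card ι : ℝ) / 2 ≤ ∑ i, (sgn (s i) - sgn (s' i)) ^ 2 := by
  classical
  set m : ℝ := (Fintype.card ι : ℝ) with hm
  have hm1 : 1 ≤ m := by rw [hm]; exact_mod_cast hι
  -- For sign vectors, squared distance is `2 m - 2 ⟨s, s'⟩`, so correlation below `3 m / 4` means
  -- squared distance above `m / 2`. The balls around a maximal such set cover `S`, and Hoeffding
  -- bounds the size of each ball.
  let P : Finset (ι → Bool) → Prop := fun T => T ⊆ S ∧ ∀ s ∈ T, ∀ s' ∈ T, s ≠ s' →
    ∑ i, sgn (s i) * sgn (s' i) < 3 * m / 4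
  obtain ⟨T, hT, hmax⟩ := Finset.exists_max_image
    (Finset.univ.filter P) Finset.card ⟨∅, by simp [P]⟩
  simp only [Finset.mem_filter, Finset.mem_univ, true_and] at hT hmax
  refine ⟨T, hT.1, ?_, ?_⟩
  · let Bl : (ι → Bool) → Finset (ι → Bool) := fun s' => {s | 3 * m / 4 ≤ ∑ i, sgn (s' i) * sgn (s i)}
    have hcov : S ⊆ T.biUnion Bl := by
      intro s hs
      by_contra hcon
      have hfar : ∀ s' ∈ T, ∑ i, sgn (s' i) * sgn (s i) < 3 * m / 4 := by
        intro s' hs'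
        by_contra! h
        exact hcon (Finset.mem_biUnion.2 ⟨s', hs', by simpa [Bl] using h⟩)
      have hsT : s ∉ T := fun h => by
        have := hfar s h
        simp only [sgn_mul_self, Finset.sum_const, Finset.card_univ, nsmul_eq_mul, mul_one] at this
        linarith
      have hP : P (insert s T) := by
        refine ⟨Finset.insert_subset hs hT.1, ?_⟩
        intro a ha b hb hab
        rcases Finset.mem_insert.1 ha with rfl | ha' <;> rcases Finset.mem_insert.1 hb with rfl | hb'
        · exact absurd rfl hab
        · simpa only [mul_comm] using hfar b hb'
        · exact hfar a ha'
        · exact hT.2 a ha' b hb' hab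
      have := hmax _ hP
      rw [Finset.card_insert_of_notMem hsT] at this
      omega
    have hball : ∀ s' ∈ T, ((Bl s').card : ℝ) ≤ 2 ^ Fintype.card ι * Real.exp (-(9 * m / 32)) := by
      intro s' _
      refine (card_signs_le (fun i => sgn (s' i)) (t := 3 * m / 4) (v := m) (by linarith)
        (by linarith) ?_).trans_eq ?_
      · simp [sq, sgn_mul_self, hm]
      · congr 3
        field_simp
        ring
    have h1 : (S.card : ℝ) ≤ T.card * (2 ^ Fintype.card ι * Real.exp (-(9 * m / 32))) := by
      have h2 : (S.card : ℝ) ≤ ∑ s' ∈ T, ((Bl s').card : ℝ) := by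
        exact_mod_cast (Finset.card_le_card hcov).trans Finset.card_biUnion_le
      refine h2.trans ((Finset.sum_le_sum hball).trans_eq ?_)
      rw [Finset.sum_const, nsmul_eq_mul]
    have h3 : (9 / 10 : ℝ) ≤ T.card * Real.exp (-(9 * m / 32)) := by
      have h4 := hS.trans h1
      rw [mul_left_comm] at h4
      exact le_of_mul_le_mul_left h4 (by positivity)
    rw [Real.exp_neg, ← div_eq_mul_inv, le_div_iff₀ (Real.exp_pos _)] at h3
    refine le_trans ?_ h3
    have h5 : Real.exp (9 * m / 32) = Real.exp (m / 8) * Real.exp (5 * m / 32) := by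
      rw [← Real.exp_add]
      ring_nf
    -- The gap between the exponents `9 m / 32` and `m / 8` absorbs the fraction 9/10.
    have h6 : (10 / 9 : ℝ) ≤ Real.exp (5 * m / 32) := by
      refine le_trans ?_ (Real.add_one_le_exp _)
      linarith
    rw [h5]
    nlinarith [Real.exp_pos (m / 8)]
  · intro s hs s' hs' hne
    have h := hT.2 s hs s' hs' hne
    have h2 : ∑ i, (sgn (s i) - sgn (s' i)) ^ 2 = 2 * m - 2 * ∑ i, sgn (s i) * sgn (s' i) := by
      have : ∀ i, (sgn (s i) - sgn (s' i)) ^ 2 = 2 - 2 * (sgn (s i) * sgn (s' i)) := by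
        intro i
        have h1 := sgn_mul_self (s i)
        have h2 := sgn_mul_self (s' i)
        linear_combination h1 + h2
      simp_rw [this, Finset.sum_sub_distrib, ← Finset.mul_sum]
      simp [hm, mul_comm]
    linarith

end Signs

end ChannelLearning

/-! ### Packings of sign tensors with two norm constraints -/

namespace ChannelLearning

/-- The exchange of the last two factors of a triple product. -/
def prodRotate (b a e : Type*) : (b × a) × e ≃ (b × e) × a where
  toFun x := ((x.1.1, x.2), x.1.2)
  invFun x := ((x.1.1, x.2), x.1.2)

/-- A large separated set of sign tensors with two small operator norms. -/
lemma exists_sign_packing (b e a : Type*) [Fintype b] [Fintype e] [Fintype a] [DecidableEq b]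
    [DecidableEq e] [DecidableEq a] [Nonempty b] [Nonempty e] [Nonempty a]
    (hae : Fintype.card a ≤ Fintype.card b * Fintype.card e)
    (hea : Fintype.card e ≤ Fintype.card b * Fintype.card a) :
    ∃ T : Finset ((b × e) × a → Bool),
      Real.exp ((Fintype.card b * Fintype.card e * Fintype.card a : ℝ) / 8) ≤ (T.card : ℝ) ∧
      (∀ s ∈ T, OpBound (Matrix.of fun i j => sgn (s (i, j)))
        (16 * Real.sqrt (Fintype.card b * Fintype.card e))) ∧
      (∀ s ∈ T, OpBound (Matrix.of fun (i : b × a) (j : e) => sgn (s ((i.1, j), i.2)))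
        (16 * Real.sqrt (Fintype.card b * Fintype.card a))) ∧
      ∀ s ∈ T, ∀ s' ∈ T, s ≠ s' →
        (Fintype.card b * Fintype.card e * Fintype.card a : ℝ) / 2 ≤
          ∑ i, (sgn (s i) - sgn (s' i)) ^ 2 := by
  have hb := Fintype.card_pos (α := b)
  have he := Fintype.card_pos (α := e)
  have ha := Fintype.card_pos (α := a)
  have hbe := Nat.mul_pos hb he
  have hba := Nat.mul_pos hb ha
  obtain ⟨B1, hB1, hB1'⟩ := card_signMatrix_le (Equiv.refl ((b × e) × a))
    (w := Fintype.card b * Fintype.card e)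
    (by rw [Fintype.card_prod]; omega) (by
      rw [Fintype.card_prod]
      have : (Fintype.card a : ℝ) ≤ Fintype.card b * Fintype.card e := by exact_mod_cast hae
      push_cast
      linarith)
  obtain ⟨B2, hB2, hB2'⟩ := card_signMatrix_le (prodRotate b a e)
    (w := Fintype.card b * Fintype.card a)
    (by rw [Fintype.card_prod]; omega) (by
      rw [Fintype.card_prod]
      have : (Fintype.card e : ℝ) ≤ Fintype.card b * Fintype.card a := by exact_mod_cast hea
      push_cast
      linarith)
  have hcard : Fintype.card ((b × e) × a) = Fintype.card b * Fintype.card e * Fintype.card a := by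
    simp
  -- Each of the two matrix shapes excludes at most 1/20 of the arrays.
  have hS : 2 ^ Fintype.card ((b × e) × a) * (9 / 10 : ℝ) ≤ ((B1 ∪ B2)ᶜ : Finset _).card := by
    rw [Finset.card_compl, Nat.cast_sub (Finset.card_le_univ _), Fintype.card_fun, Fintype.card_bool]
    have : ((B1 ∪ B2).card : ℝ) ≤ B1.card + B2.card := by exact_mod_cast Finset.card_union_le _ _
    push_cast at *
    linarith
  obtain ⟨T, hTS, hT, hsep⟩ := exists_separated_signs (by rw [hcard]; positivity) _ hS
  rw [hcard] at hT hsep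
  push_cast at hT hsep
  have hmem : ∀ s ∈ T, s ∉ B1 ∧ s ∉ B2 := fun s hs => by simpa using hTS hs
  exact ⟨T, hT, fun s hs => hB1' s (hmem s hs).1, fun s hs => hB2' s (hmem s hs).2, hsep⟩

end ChannelLearning

namespace ChannelLearning

/-! ### Discrimination of vectors in a small space -/

open Matrix

/-- A barycentric spanner: finitely many vectors have coordinates of modulus at most one
with respect to a suitable subfamily. -/
lemma exists_barycentric_spanner {X E : Type*} [Finite X] [Nonempty X] [AddCommGroup E]
    [Module ℂ E] (v : X → E) :
    ∃ (D : ℕ) (t : Fin D → X), LinearIndependent ℂ (v ∘ t) ∧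
      ∀ x, ∃ a : Fin D → ℂ, (∀ k, ‖a k‖ ≤ 1) ∧ v x = ∑ k, a k • v (t k) := by
  classical
  let S := Submodule.span ℂ (Set.range v)
  have : Module.Finite ℂ S := FiniteDimensional.span_of_finite ℂ (Set.finite_range v)
  obtain ⟨f, hf, hspan, hli⟩ := Submodule.exists_fun_fin_finrank_span_eq ℂ (Set.range v)
  choose t0 ht0 using hf
  let w : X → S := fun x => ⟨v x, Submodule.subset_span ⟨x, rfl⟩⟩
  let e : Module.Basis (Fin (Module.finrank ℂ S)) ℂ S := Module.finBasis ℂ S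
  have : Nonempty (Fin (Module.finrank ℂ S) → X) := ⟨t0⟩
  -- The subfamily of largest determinant works: by Cramer's rule each coordinate of `v x` is a
  -- quotient of determinants whose denominator is the maximal one.
  obtain ⟨t, ht⟩ := Finite.exists_max fun t : Fin (Module.finrank ℂ S) → X => ‖e.det (w ∘ t)‖
  have hli0 : LinearIndependent ℂ (w ∘ t0) := by
    apply LinearIndependent.of_comp S.subtype
    have : S.subtype ∘ w ∘ t0 = f := by
      ext i
      simp [w, ht0]
    rw [this]
    exact hli
  have hb0 : e.det (w ∘ t0) ≠ 0 := by
    have h0 := e.isUnit_det (Module.Basis.mk hli0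
      (hli0.span_eq_top_of_card_eq_finrank' (by simp [S])).ge)
    rw [Module.Basis.coe_mk] at h0
    exact h0.ne_zero
  have hbt : e.det (w ∘ t) ≠ 0 := by
    have := ht t0
    intro h
    rw [h, norm_zero] at this
    exact hb0 (norm_le_zero_iff.1 this)
  obtain ⟨hlit, hspt⟩ := e.is_basis_iff_det.2 (isUnit_iff_ne_zero.2 hbt)
  refine ⟨_, t, hlit.map' S.subtype (Submodule.ker_subtype S), fun x => ?_⟩
  refine ⟨fun k => (Module.Basis.mk hlit hspt.ge).coord k (w x), fun k => ?_, ?_⟩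
  · have h1 := congrArg (fun g => g (w x)) (e.det_smul_mk_coord_eq_det_update hlit hspt.ge k)
    have h2 : e.det (w ∘ t) * (Module.Basis.mk hlit hspt.ge).coord k (w x) =
        e.det (w ∘ Function.update t k x) := by
      rw [Function.comp_update]
      exact h1
    have h3 := ht (Function.update t k x)
    simp only [← h2, norm_mul] at h3
    exact le_of_mul_le_mul_left (by simpa using h3) (norm_pos_iff.2 hbt)
  · have h1 := (Module.Basis.mk hlit hspt.ge).sum_repr (w x)
    have h2 := congrArg S.subtype h1
    rw [map_sum] at h2
    simpa [w] using h2.symm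

/-- The value of the quadratic form of a matrix. -/
def quadForm {ι : Type*} [Fintype ι] (Q : Matrix ι ι ℂ) (v : ι → ℂ) : ℝ :=
  (star v ⬝ᵥ Q *ᵥ v).re

lemma quadForm_nonneg {ι : Type*} [Fintype ι] {Q : Matrix ι ι ℂ} (hQ : Q.PosSemidef)
    (v : ι → ℂ) : 0 ≤ quadForm Q v := hQ.re_dotProduct_nonneg v

/-- Cauchy–Schwarz applied to each rank-one component of `Q`; it costs the factor `D`. -/
lemma quadForm_sum_le {ι : Type*} [Fintype ι] {Q : Matrix ι ι ℂ}
    (hQ : Q.PosSemidef) {D : ℕ} (a : Fin D → ℂ) (ha : ∀ k, ‖a k‖ ≤ 1) (v : Fin D → ι → ℂ) :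
    quadForm Q (∑ k, a k • v k) ≤ D * ∑ k, quadForm Q (v k) := by
  obtain ⟨m, W, rfl⟩ := Matrix.posSemidef_iff_eq_sum_vecMulVec.mp hQ
  have hq : ∀ u, quadForm (∑ e, vecMulVec (W e) (star (W e))) u =
      ∑ e, ‖star (W e) ⬝ᵥ u‖ ^ 2 := by
    intro u
    rw [quadForm, sum_mulVec, dotProduct_sum, Complex.re_sum]
    refine Finset.sum_congr rfl fun e _ => ?_
    rw [vecMulVec_mulVec, dotProduct_smul, star_dotProduct u (W e), MulOpposite.smul_eq_mul_unop,
      MulOpposite.unop_op, RCLike.star_def,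
      ← Complex.normSq_eq_conj_mul_self, Complex.ofReal_re, Complex.normSq_eq_norm_sq]
  simp only [hq]
  rw [Finset.sum_comm, Finset.mul_sum]
  refine Finset.sum_le_sum fun e _ => ?_
  have h2 : ‖star (W e) ⬝ᵥ ∑ k, a k • v k‖ ≤ ∑ k, ‖star (W e) ⬝ᵥ v k‖ := by
    rw [dotProduct_sum]
    refine (norm_sum_le _ _).trans (Finset.sum_le_sum fun k _ => ?_)
    rw [dotProduct_smul, norm_smul]
    exact mul_le_of_le_one_left (norm_nonneg _) (ha k)
  refine (pow_le_pow_left₀ (norm_nonneg _) h2 2).trans ?_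
  simpa using sq_sum_le_card_mul_sum_sq (s := Finset.univ) (f := fun k => ‖star (W e) ⬝ᵥ v k‖)

/-- Vectors in a `d`-dimensional space cannot be discriminated with a total probability
of success above `d ^ 2`. -/
lemma sum_quadForm_le {X ι : Type*} [Fintype X] [Fintype ι]
    (v : X → ι → ℂ) (Q : X → Matrix ι ι ℂ) (hQ : ∀ x, (Q x).PosSemidef)
    (h : ∀ y, ∑ x, quadForm (Q x) (v y) ≤ 1) :
    ∑ x, quadForm (Q x) (v x) ≤ (Fintype.card ι : ℝ) ^ 2 := by
  rcases isEmpty_or_nonempty X with hX | hX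
  · simp
  obtain ⟨D, t, hli, hs⟩ := exists_barycentric_spanner v
  have hD : D ≤ Fintype.card ι := by
    simpa using hli.fintype_card_le_finrank
  have h1 : ∀ x, quadForm (Q x) (v x) ≤ D * ∑ k, quadForm (Q x) (v (t k)) := by
    intro x
    obtain ⟨a, ha, hx⟩ := hs x
    rw [hx]
    exact quadForm_sum_le (hQ x) a ha _
  -- The spanner consists of vectors of the family itself, so the normalization `h` applies to each
  -- of its `D` members. This is the second factor `D`.
  refine (Finset.sum_le_sum fun x _ => h1 x).trans ?_
  rw [← Finset.mul_sum, Finset.sum_comm, sq]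
  have h2 : ∑ k, ∑ x, quadForm (Q x) (v (t k)) ≤ D := by
    refine (Finset.sum_le_sum fun k _ => h (t k)).trans_eq ?_
    simp
  have hD' : (D : ℝ) ≤ Fintype.card ι := by exact_mod_cast hD
  exact mul_le_mul hD' (h2.trans hD')
    (Finset.sum_nonneg fun k _ => Finset.sum_nonneg fun x _ => quadForm_nonneg (hQ x) _)
    (by positivity)

end ChannelLearning

namespace ChannelLearning

open Matrix

/-! ### Gram decompositions -/

/-- `J = ∑ e, |W e⟩⟨W e|`. -/
def IsGram {p e : Type*} [Fintype e] (J : Matrix p p ℂ) (W : e → p → ℂ) : Prop :=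
  ∀ i j, J i j = ∑ k, W k i * star (W k j)

section Gram

variable {p e : Type*} [Fintype e]

lemma IsGram.posSemidef [Finite p] {J : Matrix p p ℂ} {W : e → p → ℂ} (h : IsGram J W) :
    J.PosSemidef := by
  have : J = ∑ k, vecMulVec (W k) (star (W k)) := by
    ext i j
    rw [h, Matrix.sum_apply]
    rfl
  rw [this]
  exact posSemidef_sum _ fun k _ => posSemidef_vecMulVec_self_star _

lemma exists_isGram [Finite p] {J : Matrix p p ℂ} (hJ : J.PosSemidef) :
    ∃ (m : ℕ) (W : Fin m → p → ℂ), IsGram J W := by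
  obtain ⟨m, W, rfl⟩ := Matrix.posSemidef_iff_eq_sum_vecMulVec.mp hJ
  refine ⟨m, W, fun i j => ?_⟩
  rw [Matrix.sum_apply]
  rfl

lemma exists_isGram_of_rank_le [Fintype p] {J : Matrix p p ℂ} (hJ : J.PosSemidef) {r : ℕ}
    (hr : J.rank ≤ r) : ∃ W : Fin r → p → ℂ, IsGram J W := by
  classical
  have hH := hJ.isHermitian
  set ev := hH.eigenvalues with hev
  have hcard : Fintype.card {i // ev i ≠ 0} ≤ Fintype.card (Fin r) := by
    rw [← hH.rank_eq_card_non_zero_eigs]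
    simpa using hr
  obtain ⟨φ⟩ := Function.Embedding.nonempty_of_card_le hcard
  have hent : ∀ i j, J i j = ∑ k, (Real.sqrt (ev k) * hH.eigenvectorUnitary.1 i k) *
      star (Real.sqrt (ev k) * hH.eigenvectorUnitary.1 j k) := by
    intro i j
    conv_lhs => rw [hH.spectral_theorem, Unitary.conjStarAlgAut_apply]
    rw [Matrix.mul_apply]
    refine Finset.sum_congr rfl fun k _ => ?_
    rw [Matrix.mul_diagonal, Matrix.star_apply]
    have h1 : (Real.sqrt (ev k) : ℂ) * (Real.sqrt (ev k) : ℂ) = (ev k : ℂ) := by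
      rw [← Complex.ofReal_mul, Real.mul_self_sqrt (hJ.eigenvalues_nonneg k)]
    simp only [Function.comp_apply, StarMul.star_mul, RCLike.star_def, Complex.conj_ofReal]
    rw [show (RCLike.ofReal (hH.eigenvalues k) : ℂ) = (ev k : ℂ) from rfl, ← h1]
    ring
  let V : p → p → ℂ := fun k i => Real.sqrt (ev k) * hH.eigenvectorUnitary.1 i k
  -- The scaled eigenvectors of nonzero eigenvalue are indexed injectively by `Fin r`, and zero
  -- vectors pad the rest.
  refine ⟨Function.extend φ (fun k => V k.1) 0, fun i j => ?_⟩
  have h1 : ∑ k, Function.extend φ (fun k => V k.1) 0 k i *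
      star (Function.extend φ (fun k => V k.1) 0 k j) =
      ∑ k : {i // ev i ≠ 0}, V k.1 i * star (V k.1 j) := by
    symm
    refine Finset.sum_of_injOn φ φ.injective.injOn (by simp) ?_ ?_
    · intro k _ hk
      rw [Function.extend_apply' _ _ _ (by simpa using hk)]
      simp
    · intro k _
      simp only [φ.injective.extend_apply]
  rw [h1, hent]
  symm
  refine Finset.sum_of_injOn Subtype.val Subtype.val_injective.injOn (by simp) ?_ fun _ _ => rfl
  intro k _ hk
  have : ev k = 0 := by
    by_contra h
    exact hk ⟨⟨k, h⟩, by simp⟩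
  simp [this]

/-- A diagonal entry is the sum of the squared moduli of that coordinate. Together with
`IsGram.eq_of_eq_one` this reads off the shape of all Kraus operators from a few Choi entries. -/
lemma IsGram.eq_zero {J : Matrix p p ℂ} {W : e → p → ℂ} (h : IsGram J W) {i : p}
    (hi : J i i = 0) (k : e) : W k i = 0 := by
  have h1 := h i i
  rw [hi] at h1
  have h2 : ∀ k, W k i * star (W k i) = ((‖W k i‖ ^ 2 : ℝ) : ℂ) := fun k => by
    rw [RCLike.star_def, Complex.mul_conj, Complex.normSq_eq_norm_sq]
  simp_rw [h2, ← Complex.ofReal_sum] at h1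
  have h3 := Complex.ofReal_eq_zero.1 h1.symm
  have h4 := (Finset.sum_eq_zero_iff_of_nonneg (fun _ _ => sq_nonneg _)).1 h3 k (Finset.mem_univ _)
  simpa using h4

/-- The differences `W k i - W k j` have total squared modulus `1 - 1 - 1 + 1 = 0`. -/
lemma IsGram.eq_of_eq_one {J : Matrix p p ℂ} {W : e → p → ℂ} (h : IsGram J W) {i j : p}
    (hii : J i i = 1) (hij : J i j = 1) (hji : J j i = 1) (hjj : J j j = 1) (k : e) :
    W k i = W k j := by
  have h1 : IsGram (fun _ _ : Unit => (0 : ℂ)) fun k (_ : Unit) => W k i - W k j := by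
    intro _ _
    have : ∑ k, (W k i - W k j) * star (W k i - W k j) = J i i - J i j - J j i + J j j := by
      rw [h i i, h i j, h j i, h j j, ← Finset.sum_sub_distrib, ← Finset.sum_sub_distrib,
        ← Finset.sum_add_distrib]
      refine Finset.sum_congr rfl fun k _ => ?_
      rw [star_sub]
      ring
    rw [this, hii, hij, hji, hjj]
    norm_num
  exact sub_eq_zero.1 (h1.eq_zero (i := ()) rfl k)

lemma IsGram.eq_mul_conjTranspose {J : Matrix p p ℂ} {W : e → p → ℂ} (h : IsGram J W) :
    J = Matrix.of (fun i k => W k i) * (Matrix.of fun i k => W k i)ᴴ := by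
  ext i j
  rw [h, Matrix.mul_apply]
  rfl

end Gram

/-! ### Choi operators -/

lemma apply_eq_sum_choi {a b : Type} [Fintype a] [DecidableEq a] (Φ : SuperOp a b)
    (X : Matrix a a ℂ) (k l : b) : Φ X k l = ∑ i, ∑ j, X i j * choi Φ (i, k) (j, l) := by
  conv_lhs => rw [matrix_eq_sum_single X]
  simp only [map_sum, Matrix.sum_apply, choi, Matrix.of_apply]
  refine Finset.sum_congr rfl fun i _ => Finset.sum_congr rfl fun j _ => ?_
  have : single i j (X i j) = X i j • single i j (1 : ℂ) := by simp [smul_single]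
  rw [this, map_smul, Matrix.smul_apply, smul_eq_mul]

lemma IsChannel.choi_posSemidef {a b : Type} [Fintype a] [DecidableEq a] [Fintype b]
    {Φ : SuperOp a b} (h : IsChannel Φ) : (choi Φ).PosSemidef := by
  let φ := Fintype.equivFin a
  -- The Choi operator is, up to reindexing, the image of the unnormalized maximally entangled
  -- projector.
  let v : a × Fin (Fintype.card a) → ℂ := fun x => if φ x.1 = x.2 then 1 else 0
  have h1 := h.completely_positive _ _ (posSemidef_vecMulVec_self_star v)
  convert h1.submatrix fun x : a × b => (x.2, φ x.1) using 1
  ext x y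
  simp only [choi, ampliate, Matrix.of_apply, submatrix_apply]
  have h2 : single x.1 y.1 (1 : ℂ) =
      of fun i j => vecMulVec v (star v) (i, φ x.1) (j, φ y.1) := by
    ext i j
    simp only [single_apply, Matrix.of_apply, vecMulVec_apply, v, Pi.star_apply,
      φ.injective.eq_iff]
    by_cases h1 : x.1 = i <;> by_cases h2 : y.1 = j <;> simp [h1, h2] <;> grind
  rw [h2]

section DirectSum

variable {a b c d : Type} [Fintype a] [Fintype b] [Fintype c] [Fintype d]

lemma IsChannel.directSum {Φ : SuperOp a b} {Ψ : SuperOp c d} (hΦ : IsChannel Φ)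
    (hΨ : IsChannel Ψ) : IsChannel (directSum Φ Ψ) := by
  refine ⟨fun k X hX => ?_, fun X => ?_⟩
  · have h1 := hΦ.completely_positive k _ (hX.submatrix fun x : a × Fin k => (Sum.inl x.1, x.2))
    have h2 := hΨ.completely_positive k _ (hX.submatrix fun x : c × Fin k => (Sum.inr x.1, x.2))
    obtain ⟨m, W, hW⟩ := exists_isGram h1
    obtain ⟨m', W', hW'⟩ := exists_isGram h2
    refine IsGram.posSemidef (W := fun (e : Fin m ⊕ Fin m') (x : (b ⊕ d) × Fin k) =>
      Sum.elim (fun e => Sum.elim (fun y => W e (y, x.2)) (fun _ => 0) x.1)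
        (fun e => Sum.elim (fun _ => 0) (fun y => W' e (y, x.2)) x.1) e) ?_
    rintro ⟨x | x, f⟩ ⟨y | y, f'⟩
    · simpa using! hW (x, f) (y, f')
    · simp [ampliate, ChannelLearning.directSum]
    · simp [ampliate, ChannelLearning.directSum]
    · simpa using! hW' (x, f) (y, f')
  · have h1 := hΦ.trace_preserving X.toBlocks₁₁
    have h2 := hΨ.trace_preserving X.toBlocks₂₂
    simp only [trace, Fintype.sum_sum_type, diag_apply] at h1 h2 ⊢
    simpa [ChannelLearning.directSum, toBlocks₁₁, toBlocks₂₂] using congrArg₂ (· + ·) h1 h2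

end DirectSum

end ChannelLearning

namespace ChannelLearning

open Matrix

lemma rank_add_le_add {p q : Type*} [Fintype p] [Fintype q] (A B : Matrix p q ℂ) :
    (A + B).rank ≤ A.rank + B.rank := by
  have h : LinearMap.range (A + B).mulVecLin ≤
      LinearMap.range A.mulVecLin ⊔ LinearMap.range B.mulVecLin := by
    rw [Matrix.mulVecLin_add]
    exact LinearMap.range_add_le _ _
  exact (Submodule.finrank_mono h).trans (Submodule.finrank_add_le_finrank_add_finrank _ _)

lemma choi_id_apply {a : Type} [Fintype a] [DecidableEq a] (x y : a × a) :
    choi (LinearMap.id : SuperOp a a) x y = if x.1 = x.2 ∧ y.1 = y.2 then 1 else 0 := by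
  simp [choi, single_apply]

/-! ### Controlled channels -/

section Controlled

variable {a b : Type} [Fintype a] [DecidableEq a] [Fintype b]
  {Φ : SuperOp a b} {Ψ : SuperOp (a ⊕ a) (a ⊕ b)}

/-- Kraus operators of the form `c • 1 ⊕ B`, as vectors. -/
def controlledVec (c : ℂ) (B : a × b → ℂ) : (a ⊕ a) × (a ⊕ b) → ℂ
  | (Sum.inl i, Sum.inl j) => if i = j then c else 0
  | (Sum.inr i, Sum.inr j) => B (i, j)
  | _ => 0

lemma IsControlled.choi_inl (h : IsControlled Φ Ψ) (i j : a) (k l : a ⊕ b) :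
    choi Ψ (Sum.inl i, k) (Sum.inl j, l) = fromBlocks (single i j 1) 0 0 0 k l := by
  rw [← h.off]
  simp only [choi, of_apply]
  have : single (Sum.inl i : a ⊕ a) (Sum.inl j : a ⊕ a) (1 : ℂ) = fromBlocks (single i j 1) 0 0 0 := by
    ext x y
    rcases x with x | x <;> rcases y with y | y <;> simp [single_apply]
  rw [this]

lemma IsControlled.choi_inr (h : IsControlled Φ Ψ) (i j : a) (k l : a ⊕ b) :
    choi Ψ (Sum.inr i, k) (Sum.inr j, l) = fromBlocks 0 0 0 (Φ (single i j 1)) k l := by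
  rw [← h.on]
  simp only [choi, of_apply]
  have : single (Sum.inr i : a ⊕ a) (Sum.inr j : a ⊕ a) (1 : ℂ) = fromBlocks 0 0 0 (single i j 1) := by
    ext x y
    rcases x with x | x <;> rcases y with y | y <;> simp [single_apply]
  rw [this]

/-- The conditions `off` and `on` fix all diagonal blocks of the Choi operator. Vanishing diagonal
entries forbid transitions between the two control states, and the block of the identity channel
forces each Kraus operator to be scalar on the off-branch. Only coherences between the branches
remain free. -/
lemma IsControlled.gram_eq (h : IsControlled Φ Ψ) {e : Type*} [Fintype e]
    {W : e → (a ⊕ a) × (a ⊕ b) → ℂ} (hW : IsGram (choi Ψ) W) (i₀ : a) (k : e) :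
    W k = controlledVec (W k (Sum.inl i₀, Sum.inl i₀)) fun x => W k (Sum.inr x.1, Sum.inr x.2) := by
  ext ⟨i | i, j | j⟩
  · simp only [controlledVec]
    split_ifs with hij
    · subst hij
      apply hW.eq_of_eq_one <;> rw [h.choi_inl] <;> simp
    · apply hW.eq_zero
      rw [h.choi_inl]
      simp [hij]
  · apply hW.eq_zero
    rw [h.choi_inl]
    simp
  · apply hW.eq_zero
    rw [h.choi_inr]
    simp
  · rfl

lemma IsControlled.exists_isGram [Nonempty a] [DecidableEq b] (h : IsControlled Φ Ψ) {r : ℕ}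
    {K : Fin r → a × b → ℂ} (hK : IsGram (choi Φ) K) :
    ∃ (c : Fin (r + 1) → ℂ) (B : Fin (r + 1) → a × b → ℂ),
      IsGram (choi Ψ) fun k => controlledVec (c k) (B k) := by
  have hpsd := h.channel.choi_posSemidef
  obtain ⟨i₀⟩ := ‹Nonempty a›
  suffices hr : (choi Ψ).rank ≤ r + 1 by
    obtain ⟨W, hW⟩ := exists_isGram_of_rank_le hpsd hr
    refine ⟨fun k => W k (Sum.inl i₀, Sum.inl i₀), fun k x => W k (Sum.inr x.1, Sum.inr x.2), ?_⟩
    convert hW using 2 with k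
    exact (h.gram_eq hW i₀ k).symm
  obtain ⟨m, W, hW⟩ := ChannelLearning.exists_isGram hpsd
  -- The matrix of Kraus vectors splits into its off-branch part, which is an outer product, and its
  -- on-branch part, which has the same Gram operator as the Kraus vectors of `Φ`. The ranks are at
  -- most `1` and `r`.
  rw [hW.eq_mul_conjTranspose, rank_self_mul_conjTranspose]
  let W₁ : Matrix ((a ⊕ a) × (a ⊕ b)) (Fin m) ℂ :=
    vecMulVec (controlledVec 1 0) fun k => W k (Sum.inl i₀, Sum.inl i₀)
  let W₂ : Matrix ((a ⊕ a) × (a ⊕ b)) (Fin m) ℂ :=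
    of fun x k => controlledVec 0 (fun y => W k (Sum.inr y.1, Sum.inr y.2)) x
  let K₂ : Matrix ((a ⊕ a) × (a ⊕ b)) (Fin r) ℂ := of fun x k => controlledVec 0 (K k) x
  have hsum : (of fun x k => W k x) = W₁ + W₂ := by
    ext x k
    rw [of_apply, h.gram_eq hW i₀ k]
    obtain ⟨x | x, y | y⟩ := x <;> simp [W₁, W₂, vecMulVec_apply, controlledVec]
  have h2 : W₂ * W₂ᴴ = K₂ * K₂ᴴ := by
    ext x y
    simp only [mul_apply, W₂, K₂, of_apply, conjTranspose_apply]
    obtain ⟨x | x, x' | x'⟩ := x <;> obtain ⟨y | y, y' | y'⟩ := y <;>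
      simp only [controlledVec, star_zero, mul_zero, zero_mul, ite_self, Finset.sum_const_zero]
    rw [← hW, ← hK, h.choi_inr]
    simp [choi]
  rw [hsum]
  refine (rank_add_le_add _ _).trans ?_
  have h3 : W₂.rank ≤ r := by
    rw [← rank_self_mul_conjTranspose, h2, rank_self_mul_conjTranspose]
    simpa using K₂.rank_le_card_width
  have h4 := rank_vecMulVec_le (controlledVec (b := b) (a := a) 1 0)
    fun k => W k (Sum.inl i₀, Sum.inl i₀)
  change W₁.rank ≤ 1 at h4
  omega

end Controlled

/-! ### Inverse channels -/

section Inverse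

lemma isGram_choi_comp {a b : Type} [DecidableEq a] [Fintype b] [DecidableEq b]
    {Φ : SuperOp a b} {Ψ : SuperOp b a} {e f : Type*} [Fintype e] [Fintype f] {K : e → a × b → ℂ}
    {L : f → b × a → ℂ} (hK : IsGram (choi Φ) K) (hL : IsGram (choi Ψ) L) :
    IsGram (choi (Ψ ∘ₗ Φ)) fun (k : e × f) (x : a × a) =>
      ∑ y, K k.1 (x.1, y) * L k.2 (y, x.2) := by
  rintro ⟨i, i'⟩ ⟨j, j'⟩
  have h1 : choi (Ψ ∘ₗ Φ) (i, i') (j, j') =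
      ∑ y, ∑ z, choi Φ (i, y) (j, z) * choi Ψ (y, i') (z, j') := by
    simp only [choi, of_apply, LinearMap.comp_apply]
    rw [apply_eq_sum_choi]
    rfl
  rw [h1]
  simp only [hK (_, _) (_, _), hL (_, _) (_, _), Finset.sum_mul_sum, star_sum, Fintype.sum_prod_type]
  calc _ = ∑ y, ∑ e, ∑ z, ∑ f, K e (i, y) * star (K e (j, z)) *
        (L f (y, i') * star (L f (z, j'))) :=
        Finset.sum_congr rfl fun y _ => Finset.sum_comm
    _ = ∑ e, ∑ y, ∑ z, ∑ f, K e (i, y) * star (K e (j, z)) *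
        (L f (y, i') * star (L f (z, j'))) := Finset.sum_comm
    _ = ∑ e, ∑ y, ∑ f, ∑ z, K e (i, y) * star (K e (j, z)) *
        (L f (y, i') * star (L f (z, j'))) :=
        Finset.sum_congr rfl fun e _ => Finset.sum_congr rfl fun y _ => Finset.sum_comm
    _ = ∑ e, ∑ f, ∑ y, ∑ z, K e (i, y) * star (K e (j, z)) *
        (L f (y, i') * star (L f (z, j'))) :=
        Finset.sum_congr rfl fun e _ => Finset.sum_comm
    _ = _ := by
      refine Finset.sum_congr rfl fun e _ => Finset.sum_congr rfl fun f _ =>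
        Finset.sum_congr rfl fun y _ => Finset.sum_congr rfl fun z _ => ?_
      rw [star_mul']
      ring

variable {a b : Type} [Fintype a] [DecidableEq a] [Fintype b] [DecidableEq b]
  {Φ : SuperOp a b} {Ψ : SuperOp b a}

/-- Kraus operators of the identity channel are scalars, and not all of them vanish. -/
lemma IsGram.choi_id {e : Type*} [Fintype e] [Nonempty a] {w : e → a × a → ℂ}
    (h : IsGram (choi (LinearMap.id : SuperOp a a)) w) :
    ∃ c : e → ℂ, (∀ k x, w k x = if x.1 = x.2 then c k else 0) ∧ ∃ k, c k ≠ 0 := by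
  obtain ⟨i₀⟩ := ‹Nonempty a›
  refine ⟨fun k => w k (i₀, i₀), ?_, ?_⟩
  · rintro k ⟨i, j⟩
    split_ifs with hij
    · obtain rfl : i = j := hij
      apply h.eq_of_eq_one <;> simp [choi_id_apply]
    · apply h.eq_zero
      have : ¬ i = j := hij
      simp [choi_id_apply, this]
  · by_contra! hcon
    have := h (i₀, i₀) (i₀, i₀)
    simp [choi_id_apply, hcon] at this

/-- The inverse of a channel has Choi rank one. -/
lemma IsInverse.exists_isGram [Nonempty a] (hΦ : IsChannel Φ) (h : IsInverse Φ Ψ) :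
    ∃ w : Fin 1 → b × a → ℂ, IsGram (choi Ψ) w := by
  obtain ⟨m, K, hK⟩ := ChannelLearning.exists_isGram hΦ.choi_posSemidef
  obtain ⟨m', L, hL⟩ := ChannelLearning.exists_isGram h.channel.choi_posSemidef
  have hb : Nonempty b := by
    by_contra hb
    rw [not_nonempty_iff] at hb
    have := hΦ.trace_preserving (single (Classical.arbitrary a) (Classical.arbitrary a) 1)
    simp [trace] at this
  have h1 := isGram_choi_comp hK hL
  have h2 := isGram_choi_comp hL hK
  rw [h.left_inv] at h1
  rw [h.right_inv] at h2
  obtain ⟨c, hc, ⟨e₀, f₀⟩, hc0⟩ := h1.choi_id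
  obtain ⟨d, hd, -⟩ := h2.choi_id
  let KM : Fin m → Matrix a b ℂ := fun e => of fun i j => K e (i, j)
  let LM : Fin m' → Matrix b a ℂ := fun f => of fun i j => L f (i, j)
  -- The products of Kraus operators are scalar in both orders. Evaluating `LM f₀ * KM e₀ * LM f` in
  -- two ways makes every `LM f` proportional to `LM f₀`, so that a single Kraus operator suffices.
  have hKL : ∀ e f, KM e * LM f = c (e, f) • (1 : Matrix a a ℂ) := by
    intro e f
    ext i j
    simpa [KM, LM, mul_apply, one_apply] using hc (e, f) (i, j)
  have hLK : ∀ e f, LM f * KM e = d (f, e) • (1 : Matrix b b ℂ) := by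
    intro e f
    ext i j
    simpa [KM, LM, mul_apply, one_apply] using hd (f, e) (i, j)
  have hprop : ∀ f, d (f₀, e₀) • LM f = c (e₀, f) • LM f₀ := by
    intro f
    have h3 := congrArg (LM f₀ * ·) (hKL e₀ f)
    simp only [← Matrix.mul_assoc, hLK] at h3
    simpa using h3
  have hd0 : d (f₀, e₀) ≠ 0 := by
    intro h0
    have h3 := hprop f₀
    rw [h0, zero_smul] at h3
    have h4 : LM f₀ = 0 := by
      rcases smul_eq_zero.1 h3.symm with h | h
      exacts [absurd h hc0, h]
    have h5 := hKL e₀ f₀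
    rw [h4, Matrix.mul_zero] at h5
    rcases smul_eq_zero.1 h5.symm with h | h
    exacts [hc0 h, one_ne_zero h]
  have hL' : ∀ f x, L f x = (c (e₀, f) / d (f₀, e₀)) * L f₀ x := by
    rintro f ⟨i, j⟩
    have h3 := congrFun (congrFun (hprop f) i) j
    simp only [Matrix.smul_apply, smul_eq_mul, LM, of_apply] at h3
    field_simp
    linear_combination h3
  let s : ℝ := ∑ f, ‖c (e₀, f) / d (f₀, e₀)‖ ^ 2
  have hs : 0 ≤ s := Finset.sum_nonneg fun _ _ => sq_nonneg _
  refine ⟨fun _ x => Real.sqrt s * L f₀ x, fun x y => ?_⟩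
  have h6 : (Real.sqrt s : ℂ) * (Real.sqrt s : ℂ) =
      ∑ f, (c (e₀, f) / d (f₀, e₀)) * star (c (e₀, f) / d (f₀, e₀)) := by
    rw [← Complex.ofReal_mul, Real.mul_self_sqrt hs, Complex.ofReal_sum]
    refine Finset.sum_congr rfl fun f _ => ?_
    rw [RCLike.star_def, Complex.mul_conj, Complex.normSq_eq_norm_sq]
  have h8 : star ((Real.sqrt s : ℂ) * L f₀ y) = Real.sqrt s * star (L f₀ y) := by
    rw [star_mul', RCLike.star_def, Complex.conj_ofReal]
  have h7 : ∀ f, L f x * star (L f y) = ((c (e₀, f) / d (f₀, e₀)) *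
      star (c (e₀, f) / d (f₀, e₀))) * (L f₀ x * star (L f₀ y)) := by
    intro f
    rw [hL' f x, hL' f y, star_mul']
    ring
  rw [hL x y, Fin.sum_univ_one, h8]
  rw [Finset.sum_congr rfl fun f _ => h7 f, ← Finset.sum_mul, ← h6]
  ring

end Inverse

end ChannelLearning

namespace ChannelLearning

open Matrix

/-! ### Families of operators with linearly parametrized purifications -/

/-- The operators `J x` have purifications that depend linearly on a vector of at most `M`
complex parameters. -/
def LinearlyPurified {X p : Type} (J : X → Matrix p p ℂ) (M : ℕ) : Prop :=
  ∃ (e ι : Type) (_ : Fintype e) (_ : Fintype ι) (L : e → p → ι → ℂ) (u : X → ι → ℂ),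
    Fintype.card ι ≤ M ∧ ∀ x, IsGram (J x) fun k i => ∑ l, L k i l * u x l

lemma linearlyPurified_of_isGram {X p e : Type} [Fintype e] [Fintype p] {J : X → Matrix p p ℂ}
    {W : X → e → p → ℂ} (h : ∀ x, IsGram (J x) (W x)) :
    LinearlyPurified J (Fintype.card e * Fintype.card p) := by
  classical
  refine ⟨e, e × p, inferInstance, inferInstance, fun k i l => if l = (k, i) then 1 else 0,
    fun x l => W x l.1 l.2, by simp, fun x => ?_⟩
  simpa using h x

/-- One additional parameter switches on a fixed purification of `J₀`. The environment may grow
freely, since only the number of parameters is counted. -/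
lemma LinearlyPurified.or_const {X p : Type} [Finite p] {J : X → Matrix p p ℂ} (S : Set X)
    {M : ℕ} (h : LinearlyPurified (fun x : S => J x) M) {J₀ : Matrix p p ℂ} (hJ₀ : J₀.PosSemidef)
    (hJ : ∀ x ∉ S, J x = J₀) : LinearlyPurified J (M + 1) := by
  classical
  obtain ⟨e, ι, _, _, L, u, hc, h⟩ := h
  obtain ⟨m, W, hW⟩ := exists_isGram hJ₀
  refine ⟨e ⊕ Fin m, ι ⊕ Unit, inferInstance, inferInstance,
    fun k i l => Sum.elim (fun k => Sum.elim (fun l => L k i l) (fun _ => 0) l)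
      (fun k => Sum.elim (fun _ => 0) (fun _ => W k i) l) k,
    fun x l => if hx : x ∈ S then Sum.elim (fun l => u ⟨x, hx⟩ l) (fun _ => 0) l
      else Sum.elim (fun _ => 0) (fun _ => 1) l, by simpa using hc, fun x => ?_⟩
  by_cases hx : x ∈ S
  · intro i j
    simpa [hx] using h ⟨x, hx⟩ i j
  · intro i j
    rw [hJ x hx]
    simpa [hx] using hW i j

section DirectSum

variable {X a b c d : Type} [DecidableEq a] [DecidableEq c]

lemma choi_directSum_inl_inl (Φ : SuperOp a b) (Ψ : SuperOp c d) (i j : a) (k l : b ⊕ d) :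
    choi (directSum Φ Ψ) (Sum.inl i, k) (Sum.inl j, l) =
      fromBlocks (Φ (single i j 1)) 0 0 0 k l := by
  have h1 : (single (Sum.inl i : a ⊕ c) (Sum.inl j : a ⊕ c) (1 : ℂ)).toBlocks₁₁ = single i j 1 := by
    ext; simp [toBlocks₁₁, single_apply]
  have h2 : (single (Sum.inl i : a ⊕ c) (Sum.inl j : a ⊕ c) (1 : ℂ)).toBlocks₂₂ = 0 := by
    ext; simp [toBlocks₂₂]
  simp [choi, directSum, h1, h2]

lemma choi_directSum_inr_inr (Φ : SuperOp a b) (Ψ : SuperOp c d) (i j : c) (k l : b ⊕ d) :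
    choi (directSum Φ Ψ) (Sum.inr i, k) (Sum.inr j, l) =
      fromBlocks 0 0 0 (Ψ (single i j 1)) k l := by
  have h1 : (single (Sum.inr i : a ⊕ c) (Sum.inr j : a ⊕ c) (1 : ℂ)).toBlocks₁₁ = 0 := by
    ext; simp [toBlocks₁₁]
  have h2 : (single (Sum.inr i : a ⊕ c) (Sum.inr j : a ⊕ c) (1 : ℂ)).toBlocks₂₂ = single i j 1 := by
    ext; simp [toBlocks₂₂, single_apply]
  simp [choi, directSum, h1, h2]

lemma choi_directSum_inl_inr (Φ : SuperOp a b) (Ψ : SuperOp c d) (i : a) (j : c) (k l : b ⊕ d) :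
    choi (directSum Φ Ψ) (Sum.inl i, k) (Sum.inr j, l) = 0 := by
  have h1 : (single (Sum.inl i : a ⊕ c) (Sum.inr j : a ⊕ c) (1 : ℂ)).toBlocks₁₁ = 0 := by
    ext; simp [toBlocks₁₁]
  have h2 : (single (Sum.inl i : a ⊕ c) (Sum.inr j : a ⊕ c) (1 : ℂ)).toBlocks₂₂ = 0 := by
    ext; simp [toBlocks₂₂]
  rcases k with k | k <;> rcases l with l | l <;> simp [choi, directSum, h1, h2]

lemma choi_directSum_inr_inl (Φ : SuperOp a b) (Ψ : SuperOp c d) (i : c) (j : a) (k l : b ⊕ d) :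
    choi (directSum Φ Ψ) (Sum.inr i, k) (Sum.inl j, l) = 0 := by
  have h1 : (single (Sum.inr i : a ⊕ c) (Sum.inl j : a ⊕ c) (1 : ℂ)).toBlocks₁₁ = 0 := by
    ext; simp [toBlocks₁₁]
  have h2 : (single (Sum.inr i : a ⊕ c) (Sum.inl j : a ⊕ c) (1 : ℂ)).toBlocks₂₂ = 0 := by
    ext; simp [toBlocks₂₂]
  rcases k with k | k <;> rcases l with l | l <;> simp [choi, directSum, h1, h2]

lemma LinearlyPurified.directSum {Φ : X → SuperOp a b} {Ψ : X → SuperOp c d} {M M' : ℕ}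
    (h : LinearlyPurified (fun x => choi (Φ x)) M) (h' : LinearlyPurified (fun x => choi (Ψ x)) M') :
    LinearlyPurified (fun x => choi (directSum (Φ x) (Ψ x))) (M + M') := by
  obtain ⟨e, ι, _, _, L, u, hc, h⟩ := h
  obtain ⟨e', ι', _, _, L', u', hc', h'⟩ := h'
  -- Separate environments for the two summands remove all coherence between them.
  refine ⟨e ⊕ e', ι ⊕ ι', inferInstance, inferInstance, fun k i l => match k, i, l with
    | Sum.inl k, (Sum.inl i, Sum.inl j), Sum.inl l => L k (i, j) l
    | Sum.inr k, (Sum.inr i, Sum.inr j), Sum.inr l => L' k (i, j) l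
    | _, _, _ => 0, fun x => Sum.elim (u x) (u' x), ?_, fun x => ?_⟩
  · rw [Fintype.card_sum]
    omega
  · rintro ⟨i | i, k | k⟩ ⟨j | j, l | l⟩
    · simpa [choi_directSum_inl_inl] using! h x (i, k) (j, l)
    · simp [choi_directSum_inl_inl]
    · simp [choi_directSum_inl_inr]
    · simp [choi_directSum_inl_inr]
    · simp [choi_directSum_inl_inl]
    · simp [choi_directSum_inl_inl]
    · simp [choi_directSum_inl_inr]
    · simp [choi_directSum_inl_inr]
    · simp [choi_directSum_inr_inl]
    · simp [choi_directSum_inr_inl]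
    · simp [choi_directSum_inr_inr]
    · simp [choi_directSum_inr_inr]
    · simp [choi_directSum_inr_inl]
    · simp [choi_directSum_inr_inl]
    · simp [choi_directSum_inr_inr]
    · simpa [choi_directSum_inr_inr] using! h' x (i, k) (j, l)

end DirectSum

/-- Each of the `r + 1` Kraus operators `c • 1 ⊕ B` has the entries of `B` and the scalar `c` as
parameters. -/
lemma linearlyPurified_of_isControlled {X a b : Type} [Fintype a] [DecidableEq a] [Fintype b]
    [DecidableEq b] [Nonempty a] {Φ : X → SuperOp a b} {Ψ : X → SuperOp (a ⊕ a) (a ⊕ b)}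
    (h : ∀ x, IsControlled (Φ x) (Ψ x)) {r : ℕ} {K : X → Fin r → a × b → ℂ}
    (hK : ∀ x, IsGram (choi (Φ x)) (K x)) :
    LinearlyPurified (fun x => choi (Ψ x)) ((r + 1) * (Fintype.card a * Fintype.card b + 1)) := by
  choose c B hB using fun x => (h x).exists_isGram (hK x)
  refine ⟨Fin (r + 1), Fin (r + 1) × (a × b ⊕ Unit), inferInstance, inferInstance,
    fun k i l => if l.1 = k then Sum.elim (fun y => controlledVec 0 (Pi.single y 1) i)
      (fun _ => controlledVec 1 0 i) l.2 else 0,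
    fun x l => Sum.elim (fun y => B x l.1 y) (fun _ => c x l.1) l.2, by simp, fun x => ?_⟩
  convert hB x using 3 with k i
  simp only [Fintype.sum_prod_type, Fintype.sum_sum_type, Sum.elim_inl, Sum.elim_inr]
  rw [Finset.sum_eq_single k (by intro l _ hl; simp [hl]) (by simp)]
  obtain ⟨i | i, j | j⟩ := i <;> simp [controlledVec, Pi.single_apply, ite_and]

/-- The answers to the queries have purifications with few parameters. -/
lemma QueryModel.linearlyPurified {dA dB r : ℕ} (hA : 1 ≤ dA) (hB : 1 ≤ dB)
    (Q : QueryModel dA dB) {X : Type} {Φ : X → SuperOp (Fin dA) (Fin dB)}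
    (hΦ : ∀ x, IsChannel (Φ x)) (hr : ∀ x, choiRank (Φ x) ≤ r) :
    LinearlyPurified (fun x => choi (Q.query (Φ x)))
      ((r * (dA * dB) + (dA * dB + 1)) + ((r + 1) * (dA * dB + 1) + (2 * (dA * dB + 1) + 1))) := by
  have : Nonempty (Fin dA) := ⟨⟨0, hA⟩⟩
  have : Nonempty (Fin dB) := ⟨⟨0, hB⟩⟩
  choose K hK using fun x => exists_isGram_of_rank_le (hΦ x).choi_posSemidef (hr x)
  let S : Set X := {x | ∃ Ψ, IsInverse (Φ x) Ψ}
  have hinv : ∀ x : S, IsInverse (Φ x) (Q.inv (Φ x)) ∧ IsControlled (Q.inv (Φ x)) (Q.ctrlInv (Φ x)) :=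
    fun x => Q.inv_spec _ (hΦ x) x.2
  choose w hw using fun x : S => (hinv x).1.exists_isGram (hΦ x)
  have h1 : LinearlyPurified (fun x => choi (Φ x)) (r * (dA * dB)) := by
    simpa using linearlyPurified_of_isGram hK
  have h2 : LinearlyPurified (fun x => choi (Q.inv (Φ x))) (dA * dB + 1) := by
    refine LinearlyPurified.or_const S ?_ Q.noInv_channel.choi_posSemidef fun x hx => ?_
    · simpa [mul_comm] using linearlyPurified_of_isGram hw
    · rw [(Q.noInv_spec _ (hΦ x) hx).1]
  have h3 : LinearlyPurified (fun x => choi (Q.ctrl (Φ x))) ((r + 1) * (dA * dB + 1)) := by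
    simpa using linearlyPurified_of_isControlled (fun x => Q.ctrl_spec _ (hΦ x)) hK
  have h4 : LinearlyPurified (fun x => choi (Q.ctrlInv (Φ x))) (2 * (dA * dB + 1) + 1) := by
    refine LinearlyPurified.or_const S ?_ Q.noCtrlInv_channel.choi_posSemidef fun x hx => ?_
    · simpa [mul_comm] using linearlyPurified_of_isControlled (fun x => (hinv x).2) hw
    · rw [(Q.noInv_spec _ (hΦ x) hx).2]
  exact (h1.directSum h2).directSum (h3.directSum h4)

lemma QueryModel.isChannel_query {dA dB : ℕ} (Q : QueryModel dA dB)
    {Φ : SuperOp (Fin dA) (Fin dB)} (hΦ : IsChannel Φ) : IsChannel (Q.query Φ) := by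
  refine (hΦ.directSum ?_).directSum ((Q.ctrl_spec Φ hΦ).channel.directSum ?_)
  · by_cases h : ∃ Ψ, IsInverse Φ Ψ
    · exact (Q.inv_spec Φ hΦ h).1.channel
    · rw [(Q.noInv_spec Φ hΦ h).1]
      exact Q.noInv_channel
  · by_cases h : ∃ Ψ, IsInverse Φ Ψ
    · exact (Q.inv_spec Φ hΦ h).2.channel
    · rw [(Q.noInv_spec Φ hΦ h).2]
      exact Q.noCtrlInv_channel

end ChannelLearning

namespace ChannelLearning

open Matrix

/-! ### Testers -/

section Tester

variable {n : ℕ} {a b : Type} [DecidableEq a]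

/-- The multiset of values of a tuple. -/
def tupleSym {ι : Type} (i : Fin n → ι) : Sym ι n :=
  ⟨Finset.univ.val.map i, by simp⟩

/-- The monomial of `u` with the given multiset of indices. -/
def monomialVec {ι : Type} (u : ι → ℂ) (σ : Sym ι n) : ℂ := (σ.1.map u).prod

lemma monomialVec_tupleSym {ι : Type} (u : ι → ℂ) (i : Fin n → ι) :
    monomialVec u (tupleSym i) = ∏ j, u (i j) := by
  simp [monomialVec, tupleSym, List.prod_ofFn]

lemma IsGram.choiTensor {e : Type} [Fintype e] {C : SuperOp a b} {W : e → a × b → ℂ}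
    (h : IsGram (choi C) W) :
    IsGram (choiTensor fun _ : Fin n => C) fun (k : Fin n → e) p => ∏ j, W (k j) (p j) := by
  classical
  intro p q
  simp only [ChannelLearning.choiTensor, of_apply, star_prod, ← Finset.prod_mul_distrib]
  rw [Finset.prod_congr rfl fun j _ => h (p j) (q j), Finset.prod_univ_sum,
    Fintype.piFinset_univ]

/-- Coefficients of a product of linear forms. -/
def tensorCoeff {p e ι : Type} [Fintype ι] [DecidableEq ι] (L : e → p → ι → ℂ) (k : Fin n → e) :
    Matrix (Fin n → p) (Sym ι n) ℂ :=
  of fun x σ => ∑ i : Fin n → ι with tupleSym i = σ, ∏ j, L (k j) (x j) (i j)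

/-- Expanding the product and grouping the terms by the multiset of their indices. All dependence on
the channel sits in the monomials of `u`, and symmetry replaces the dimension `|ι| ^ n` by the
number of multisets. -/
lemma prod_linear_eq {p e ι : Type} [Fintype ι] [DecidableEq ι] (L : e → p → ι → ℂ)
    (k : Fin n → e) (u : ι → ℂ) :
    (fun x : Fin n → p => ∏ j, ∑ l, L (k j) (x j) l * u l) = tensorCoeff L k *ᵥ monomialVec u := by
  ext x
  simp only [mulVec, dotProduct, tensorCoeff, of_apply, Finset.prod_univ_sum,
    Fintype.piFinset_univ, Finset.sum_mul]
  rw [← Finset.sum_fiberwise (s := Finset.univ) (g := tupleSym)]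
  refine Finset.sum_congr rfl fun σ _ => Finset.sum_congr rfl fun i hi => ?_
  rw [← (Finset.mem_filter.1 hi).2, monomialVec_tupleSym, Finset.prod_mul_distrib]

lemma trace_mul_of_isGram {p e : Type*} [Fintype p] [Fintype e] {J : Matrix p p ℂ}
    {W : e → p → ℂ} (h : IsGram J W) (T : Matrix p p ℂ) :
    (T * J).trace = ∑ k, star (W k) ⬝ᵥ T *ᵥ W k := by
  simp only [trace, diag_apply, mul_apply, h _ _, dotProduct, mulVec, Finset.mul_sum]
  rw [Finset.sum_congr rfl fun x _ => Finset.sum_comm, Finset.sum_comm]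
  refine Finset.sum_congr rfl fun k _ => Finset.sum_congr rfl fun x _ =>
    Finset.sum_congr rfl fun y _ => ?_
  rw [Pi.star_apply]
  ring

variable [Fintype a] [Fintype b] [DecidableEq b] {Ω : Type*} [MeasurableSpace Ω]

lemma Tester.prob_eq_quadForm (T : Tester n a b Ω) {e ι : Type} [Fintype e] [Fintype ι]
    [DecidableEq ι] (L : e → a × b → ι → ℂ) {u : ι → ℂ} {C : SuperOp a b}
    (h : IsGram (choi C) fun k i => ∑ l, L k i l * u l) (E : Set Ω) :
    T.prob C E = quadForm (∑ k : Fin n → e, (tensorCoeff L k)ᴴ * T.op E * tensorCoeff L k)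
      (monomialVec u) := by
  rw [Tester.prob, trace_mul_of_isGram h.choiTensor, quadForm, sum_mulVec, dotProduct_sum]
  congr 1
  refine Finset.sum_congr rfl fun k _ => ?_
  rw [prod_linear_eq, ← mulVec_mulVec, ← mulVec_mulVec, dotProduct_mulVec _ (tensorCoeff L k)ᴴ,
    star_mulVec]

lemma Tester.prob_union (T : Tester n a b Ω) (C : SuperOp a b) {X : Type} [Fintype X]
    {E : X → Set Ω} (hE : ∀ x, MeasurableSet (E x)) (hd : Pairwise (Function.onFun Disjoint E)) :
    ∑ x, T.prob C (E x) + T.prob C (⋃ x, E x)ᶜ = T.prob C Set.univ := by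
  have h1 : T.op (⋃ x, E x) = ∑ x, T.op (E x) := by
    rw [T.op.of_disjoint_iUnion hE hd, tsum_fintype]
  have hU := MeasurableSet.iUnion hE
  have h2 : T.op Set.univ = T.op (⋃ x, E x) + T.op (⋃ x, E x)ᶜ := by
    rw [← MeasureTheory.VectorMeasure.of_union disjoint_compl_right hU hU.compl,
      Set.union_compl_self]
  simp only [Tester.prob]
  rw [h2, h1, Matrix.add_mul, Matrix.sum_mul, trace_add, trace_sum, Complex.add_re, Complex.re_sum]

/-- A tester cannot discriminate well more channels than the dimension of a space of polynomials
allows. -/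
lemma Tester.sum_prob_le (T : Tester n a b Ω) {X : Type} [Fintype X] {C : X → SuperOp a b}
    (hC : ∀ x, IsChannel (C x)) {M : ℕ} (hM : LinearlyPurified (fun x => choi (C x)) M)
    {E : X → Set Ω} (hE : ∀ x, MeasurableSet (E x))
    (hd : Pairwise (Function.onFun Disjoint E)) :
    ∑ x, T.prob (C x) (E x) ≤ (((M + n - 1).choose n : ℕ) : ℝ) ^ 2 := by
  classical
  obtain ⟨e, ι, _, _, L, u, hc, h⟩ := hM
  have hpsd : ∀ E, (∑ k : Fin n → e,
      (tensorCoeff L k)ᴴ * T.op E * tensorCoeff L k).PosSemidef := fun E =>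
    posSemidef_sum _ fun k _ => (T.posSemidef E).conjTranspose_mul_mul_same _
  have h1 : ∀ y, ∑ x, quadForm (∑ k : Fin n → e,
      (tensorCoeff L k)ᴴ * T.op (E x) * tensorCoeff L k) (monomialVec (u y)) ≤ 1 := by
    intro y
    -- For a fixed channel the disjoint events have total probability at most one, which is the
    -- normalization that `sum_quadForm_le` asks for.
    simp only [← T.prob_eq_quadForm L (h y)]
    have h2 := T.prob_union (C y) hE hd
    have h3 : T.prob (C y) Set.univ = 1 := by
      rw [Tester.prob, T.normalized _ fun _ => hC y, Complex.one_re]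
    have h4 : 0 ≤ T.prob (C y) (⋃ x, E x)ᶜ := by
      rw [T.prob_eq_quadForm L (h y)]
      exact quadForm_nonneg (hpsd _) _
    linarith
  have h2 := sum_quadForm_le _ _ (fun x => hpsd (E x)) h1
  simp only [← T.prob_eq_quadForm L (h _)] at h2
  refine h2.trans ?_
  rw [Sym.card_sym_eq_choose]
  gcongr

end Tester

end ChannelLearning

namespace ChannelLearning

open Matrix

/-! ### Lower bounds on the diamond norm -/

section Norms

open scoped Matrix.Norms.L2Operator

/-- The trace is taken in the eigenbasis `v` of `Y† Y`, where `‖Y (v i)‖` are the singular values.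
-/
lemma norm_trace_mul_le {a : Type} [Fintype a] [DecidableEq a] (O Y : Matrix a a ℂ) :
    ‖(O * Y).trace‖ ≤ ‖O‖ * traceNorm Y := by
  set hH := Matrix.isHermitian_conjTranspose_mul_self Y with hHdef
  let v := hH.eigenvectorBasis
  have h1 : (O * Y).trace = ∑ i, inner ℂ (v i) (WithLp.toLp 2 (O *ᵥ (Y *ᵥ (v i).ofLp))) := by
    have h2 : (O * Y).trace = LinearMap.trace ℂ _ (toEuclideanLin (O * Y)) := by
      rw [toEuclideanLin, toLpLin_eq_toLin, LinearMap.trace_eq_matrix_trace ℂ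
        (PiLp.basisFun 2 ℂ a), LinearMap.toMatrix_toLin]
    rw [h2, LinearMap.trace_eq_sum_inner _ v]
    refine Finset.sum_congr rfl fun i _ => ?_
    rw [mulVec_mulVec, toLpLin_apply]
  have h3 : ∀ i, ‖WithLp.toLp 2 (Y *ᵥ (v i).ofLp)‖ = Real.sqrt (hH.eigenvalues i) := by
    intro i
    have h4 : Yᴴ *ᵥ (Y *ᵥ (v i).ofLp) = hH.eigenvalues i • (v i).ofLp := by
      rw [mulVec_mulVec]
      exact hH.mulVec_eigenvectorBasis i
    have h5 : ‖WithLp.toLp 2 (Y *ᵥ (v i).ofLp)‖ ^ 2 = hH.eigenvalues i := by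
      have h6 : (v i).ofLp ⬝ᵥ star (v i).ofLp = 1 := by
        rw [← EuclideanSpace.inner_eq_star_dotProduct, inner_self_eq_norm_sq_to_K,
          v.orthonormal.1 i]
        simp
      rw [← inner_self_eq_norm_sq (𝕜 := ℂ), EuclideanSpace.inner_eq_star_dotProduct,
        dotProduct_comm, star_mulVec, ← dotProduct_mulVec, h4, dotProduct_smul, dotProduct_comm, h6]
      simp
    rw [← h5, Real.sqrt_sq (norm_nonneg _)]
  rw [h1, traceNorm, Finset.mul_sum]
  refine (norm_sum_le _ _).trans (Finset.sum_le_sum fun i _ => ?_)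
  refine (norm_inner_le_norm _ _).trans ?_
  rw [v.orthonormal.1 i, one_mul, ← h3]
  exact l2_opNorm_mulVec O (WithLp.toLp 2 (Y *ᵥ (v i).ofLp))

/-- For a projector `P`, the eigenvalues of `P† P` are idempotent, so their square roots sum to the
trace. -/
lemma traceNorm_vecMulVec {a : Type} [Fintype a] [DecidableEq a] {ψ : a → ℂ}
    (hψ : star ψ ⬝ᵥ ψ = 1) : traceNorm (vecMulVec ψ (star ψ)) = 1 := by
  set P := vecMulVec ψ (star ψ) with hP
  have hPP : Pᴴ * P = P := by
    rw [hP, conjTranspose_vecMulVec, star_star, vecMulVec_mul_vecMulVec, hψ]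
    simp
  have hPP2 : (Pᴴ * P) * (Pᴴ * P) = Pᴴ * P := by
    have : P * P = P := by
      conv_lhs => rw [hP, vecMulVec_mul_vecMulVec, hψ]
      simp [hP]
    rw [hPP, this]
  set hH := Matrix.isHermitian_conjTranspose_mul_self P with hHdef
  have h1 : ∀ i, Real.sqrt (hH.eigenvalues i) = hH.eigenvalues i := by
    intro i
    have h2 := hH.mulVec_eigenvectorBasis i
    have h3 : (Pᴴ * P) *ᵥ ((Pᴴ * P) *ᵥ (hH.eigenvectorBasis i).ofLp) =
        (Pᴴ * P) *ᵥ (hH.eigenvectorBasis i).ofLp := by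
      rw [mulVec_mulVec, hPP2]
    rw [h2, mulVec_smul, h2, smul_smul] at h3
    have h4 : (hH.eigenvectorBasis i).ofLp ≠ 0 := by
      intro h0
      have := hH.eigenvectorBasis.orthonormal.ne_zero i
      exact this (by ext j; exact congrFun h0 j)
    have h5 : hH.eigenvalues i = hH.eigenvalues i * hH.eigenvalues i :=
      (smul_left_injective ℝ h4 h3).symm
    conv_lhs => rw [h5]
    exact Real.sqrt_mul_self ((posSemidef_conjTranspose_mul_self P).eigenvalues_nonneg i)
  rw [traceNorm]
  simp only [h1]
  have h6 := hH.trace_eq_sum_eigenvalues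
  have h7 : (Pᴴ * P).trace = 1 := by
    rw [hPP, hP, trace_vecMulVec, dotProduct_comm, hψ]
  rw [h7] at h6
  have h8 := congrArg Complex.re h6
  simpa using h8.symm

lemma norm_trace_le_of_diamondNorm_le {a b : Type} [Fintype a] [DecidableEq a] [Fintype b]
    [DecidableEq b] {Λ : SuperOp a b} {ε : ℝ} (hε : 0 ≤ ε)
    (h : diamondNorm Λ ≤ ENNReal.ofReal ε) {k : ℕ} {X : Matrix (a × Fin k) (a × Fin k) ℂ}
    (hX : traceNorm X ≤ 1) {O : Matrix (b × Fin k) (b × Fin k) ℂ} (hO : ‖O‖ ≤ 1) :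
    ‖(O * ampliate Λ k X).trace‖ ≤ ε := by
  have h1 : ENNReal.ofReal (traceNorm (ampliate Λ k X)) ≤ ENNReal.ofReal ε := by
    refine le_trans ?_ h
    rw [diamondNorm]
    exact le_iSup_of_le k (le_iSup_of_le X (le_iSup_of_le hX le_rfl))
  have h2 := (ENNReal.ofReal_le_ofReal_iff hε).1 h1
  have h3 : 0 ≤ traceNorm (ampliate Λ k X) := Finset.sum_nonneg fun _ _ => Real.sqrt_nonneg _
  exact (norm_trace_mul_le _ _).trans ((mul_le_of_le_one_left h3 hO).trans h2)

/-- If an observable tells two maps apart, then no map is close to both. -/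
lemma not_diamondNorm_le_and_le {a b : Type} [Fintype a] [DecidableEq a] [Fintype b]
    [DecidableEq b] {Φ Φ' : SuperOp a b} {ε : ℝ} (hε : 0 ≤ ε) {k : ℕ}
    {X : Matrix (a × Fin k) (a × Fin k) ℂ} (hX : traceNorm X ≤ 1)
    {O : Matrix (b × Fin k) (b × Fin k) ℂ} (hO : ‖O‖ ≤ 1)
    (hsep : 2 * ε < ‖(O * ampliate Φ k X).trace - (O * ampliate Φ' k X).trace‖)
    (Ψ : SuperOp a b) :
    ¬(diamondNorm (Ψ - Φ) ≤ ENNReal.ofReal ε ∧ diamondNorm (Ψ - Φ') ≤ ENNReal.ofReal ε) := by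
  rintro ⟨h1, h2⟩
  have h3 := norm_trace_le_of_diamondNorm_le hε h1 hX hO
  have h4 := norm_trace_le_of_diamondNorm_le hε h2 hX hO
  have hsub : ∀ Θ : SuperOp a b, ampliate (Ψ - Θ) k X = ampliate Ψ k X - ampliate Θ k X :=
    fun Θ => rfl
  rw [hsub, Matrix.mul_sub, trace_sub] at h3 h4
  have h5 := norm_sub_le ((O * ampliate Ψ k X).trace - (O * ampliate Φ' k X).trace)
    ((O * ampliate Ψ k X).trace - (O * ampliate Φ k X).trace)
  rw [sub_sub_sub_cancel_left] at h5
  linarith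

end Norms

end ChannelLearning

namespace ChannelLearning

open Matrix

/-! ### Channels from isometries -/

section Kraus

variable {a b e : Type} [Fintype a] [Fintype e]

/-- The map `X ↦ Tr_E (V X V†)`. -/
def stinespring (V : Matrix (b × e) a ℂ) : SuperOp a b where
  toFun X := of fun k l => ∑ f, (V * X * Vᴴ) (k, f) (l, f)
  map_add' X Y := by
    ext k l
    simp [Matrix.mul_add, Matrix.add_mul, Finset.sum_add_distrib]
  map_smul' t X := by
    ext k l
    simp [Finset.mul_sum]

lemma stinespring_vecMulVec (V : Matrix (b × e) a ℂ) (u w : a → ℂ) (k l : b) :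
    stinespring V (vecMulVec u (star w)) k l =
      ∑ f, (V *ᵥ u) (k, f) * star ((V *ᵥ w) (l, f)) := by
  simp only [stinespring, LinearMap.coe_mk, AddHom.coe_mk, of_apply]
  refine Finset.sum_congr rfl fun f _ => ?_
  rw [mul_vecMulVec, vecMulVec_mul, vecMulVec_apply, ← star_mulVec, Pi.star_apply]

lemma isGram_choi_stinespring [DecidableEq a] (V : Matrix (b × e) a ℂ) :
    IsGram (choi (stinespring V)) fun f x => V (x.2, f) x.1 := by
  rintro ⟨i, k⟩ ⟨j, l⟩
  have h : single i j (1 : ℂ) = vecMulVec (Pi.single i 1) (star (Pi.single j 1)) := by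
    ext x y
    by_cases hx : x = i <;> by_cases hy : y = j <;>
      simp [vecMulVec_apply, hx, hy, Ne.symm]
  simp only [choi, of_apply]
  rw [h, stinespring_vecMulVec]
  simp

lemma choiRank_stinespring_le [Fintype b] [DecidableEq a] (V : Matrix (b × e) a ℂ) :
    choiRank (stinespring V) ≤ Fintype.card e := by
  rw [choiRank, (isGram_choi_stinespring V).eq_mul_conjTranspose, rank_self_mul_conjTranspose]
  exact rank_le_card_width _

lemma isChannel_stinespring [Fintype b] [DecidableEq a] {V : Matrix (b × e) a ℂ}
    (hV : Vᴴ * V = 1) : IsChannel (stinespring V) := by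
  refine ⟨fun k X hX => ?_, fun X => ?_⟩
  · obtain ⟨m, W, hW⟩ := exists_isGram hX
    refine IsGram.posSemidef (W := fun (x : e × Fin m) (p : b × Fin k) =>
      (V *ᵥ fun i => W x.2 (i, p.2)) (p.1, x.1)) fun p q => ?_
    have h1 : (of fun i j => X (i, p.2) (j, q.2)) =
        ∑ x, vecMulVec (fun i => W x (i, p.2)) (star fun j => W x (j, q.2)) := by
      ext i j
      rw [Matrix.sum_apply, of_apply, hW]
      rfl
    simp only [ampliate, of_apply]
    rw [h1, map_sum, Matrix.sum_apply, Fintype.sum_prod_type, Finset.sum_comm]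
    exact Finset.sum_congr rfl fun x _ => stinespring_vecMulVec _ _ _ _ _
  · have h1 : (stinespring V X).trace = (V * X * Vᴴ).trace := by
      simp [stinespring, trace, Fintype.sum_prod_type]
    rw [h1, trace_mul_comm, ← Matrix.mul_assoc, hV, Matrix.one_mul]

/-- An isometry defined on some basis vectors extends to the whole space if the target is
large enough. -/
lemma exists_isometry_extension {a' m : Type} [Fintype a'] [DecidableEq a'] [DecidableEq a]
    [Fintype m] [DecidableEq m] (h : Fintype.card a ≤ Fintype.card m) (f : a' ↪ a)
    {W : Matrix m a' ℂ} (hW : Wᴴ * W = 1) :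
    ∃ V : Matrix m a ℂ, Vᴴ * V = 1 ∧ ∀ i x, V i (f x) = W i x := by
  obtain ⟨j⟩ := Function.Embedding.nonempty_of_card_le h
  let g : a' ↪ m := f.trans j
  let w : a' → EuclideanSpace ℂ m := fun x => WithLp.toLp 2 fun i => W i x
  -- The columns of `W` are placed at the indices `j (f x)`. After completion to an orthonormal
  -- basis indexed by `m`, the vectors at the indices `j x` form the columns of the extension.
  let v : m → EuclideanSpace ℂ m := Function.extend g w 0
  have hon : Orthonormal ℂ ((Set.range g).domRestrict v) := by
    rw [orthonormal_iff_ite]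
    rintro ⟨_, x, rfl⟩ ⟨_, y, rfl⟩
    have h1 : inner ℂ (w x) (w y) = (Wᴴ * W) x y := by
      simp [w, EuclideanSpace.inner_eq_star_dotProduct, mul_apply, dotProduct, mul_comm]
    have h2 : ∀ z, v (g z) = w z := fun z => g.injective.extend_apply _ _ _
    rw [Set.domRestrict_apply, Set.domRestrict_apply, h2, h2, h1, hW, one_apply]
    exact if_congr ⟨fun h => Subtype.ext (congrArg g h),
      fun h => g.injective (congrArg Subtype.val h)⟩ rfl rfl
  obtain ⟨b, hb⟩ := hon.exists_orthonormalBasis_extension_of_card_eq (by simp)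
  refine ⟨of fun i x => b (j x) i, ?_, fun i x => ?_⟩
  · ext x y
    have h2 := orthonormal_iff_ite.1 b.orthonormal (j x) (j y)
    rw [EuclideanSpace.inner_eq_star_dotProduct] at h2
    simpa [mul_apply, dotProduct, one_apply, mul_comm] using h2
  · have h3 := hb (g x) ⟨x, rfl⟩
    rw [of_apply, show j (f x) = g x from rfl, h3]
    simp [v, g.injective.extend_apply, w]

end Kraus

end ChannelLearning

namespace ChannelLearning

open Matrix

/-! ### Readout of a perturbed isometry -/

section Readout

/-- Exchange of the environment with the input. -/
def reshape {b e a : Type} (X : Matrix (b × e) a ℂ) : Matrix (b × a) e ℂ :=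
  of fun p f => X (p.1, f) p.2

lemma reshape_add {b e a : Type} (X Y : Matrix (b × e) a ℂ) :
    reshape (X + Y) = reshape X + reshape Y := rfl

lemma reshape_sub {b e a : Type} (X Y : Matrix (b × e) a ℂ) :
    reshape (X - Y) = reshape X - reshape Y := rfl

lemma reshape_smul {b e a : Type} (c : ℂ) (X : Matrix (b × e) a ℂ) :
    reshape (c • X) = c • reshape X := rfl

/-- The squared Frobenius norm. -/
noncomputable def frobSq {p q : Type} [Fintype p] [Fintype q] (X : Matrix p q ℂ) : ℝ :=
  ∑ i, ∑ j, ‖X i j‖ ^ 2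

lemma frobSq_nonneg {p q : Type} [Fintype p] [Fintype q] (X : Matrix p q ℂ) : 0 ≤ frobSq X :=
  Finset.sum_nonneg fun _ _ => Finset.sum_nonneg fun _ _ => sq_nonneg _

lemma frobSq_reshape {b e a : Type} [Fintype b] [Fintype e] [Fintype a]
    (X : Matrix (b × e) a ℂ) : frobSq (reshape X) = frobSq X := by
  simp only [frobSq, Fintype.sum_prod_type, reshape, of_apply]
  exact Finset.sum_congr rfl fun _ _ => Finset.sum_comm

lemma trace_conjTranspose_mul_self {p q : Type} [Fintype p] [Fintype q] (X : Matrix p q ℂ) :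
    (Xᴴ * X).trace = frobSq X := by
  simp only [trace, diag_apply, mul_apply, conjTranspose_apply, frobSq, Complex.ofReal_sum]
  rw [Finset.sum_comm]
  refine Finset.sum_congr rfl fun i _ => Finset.sum_congr rfl fun j _ => ?_
  rw [RCLike.star_def, ← Complex.normSq_eq_conj_mul_self, Complex.normSq_eq_norm_sq]

lemma norm_trace_conjTranspose_mul_sq_le {p q : Type} [Fintype p] [Fintype q]
    (X Y : Matrix p q ℂ) : ‖(Xᴴ * Y).trace‖ ^ 2 ≤ frobSq X * frobSq Y := by
  have h1 : ‖(Xᴴ * Y).trace‖ ≤ ∑ x : p × q, ‖X x.1 x.2‖ * ‖Y x.1 x.2‖ := by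
    simp only [trace, diag_apply, mul_apply, conjTranspose_apply]
    rw [Finset.sum_comm, ← Fintype.sum_prod_type' (f := fun i j => star (X i j) * Y i j)]
    refine (norm_sum_le _ _).trans (Finset.sum_le_sum fun x _ => ?_)
    rw [norm_mul, norm_star]
  have h2 := Finset.sum_mul_sq_le_sq_mul_sq Finset.univ (fun x : p × q => ‖X x.1 x.2‖)
    fun x => ‖Y x.1 x.2‖
  refine (pow_le_pow_left₀ (norm_nonneg _) h1 2).trans (h2.trans_eq ?_)
  simp only [frobSq, Fintype.sum_prod_type]

open scoped Matrix.Norms.L2Operator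

lemma frobSq_mul_le {p q r : Type} [Fintype p] [Fintype q] [DecidableEq q] [Fintype r]
    (O : Matrix p q ℂ) (X : Matrix q r ℂ) : frobSq (O * X) ≤ ‖O‖ ^ 2 * frobSq X := by
  simp only [frobSq]
  rw [Finset.sum_comm, Finset.sum_comm (f := fun i j => ‖X i j‖ ^ 2), Finset.mul_sum]
  refine Finset.sum_le_sum fun j _ => ?_
  have h := l2_opNorm_mulVec O (WithLp.toLp 2 fun i => X i j)
  have h2 := pow_le_pow_left₀ (norm_nonneg _) h 2
  rw [mul_pow, EuclideanSpace.norm_sq_eq, EuclideanSpace.norm_sq_eq] at h2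
  exact h2

lemma frobSq_le {p q : Type} [Fintype p] [Fintype q] [DecidableEq q] (X : Matrix p q ℂ) :
    frobSq X ≤ Fintype.card q * ‖X‖ ^ 2 := by
  have h := frobSq_mul_le X (1 : Matrix q q ℂ)
  rw [Matrix.mul_one] at h
  refine h.trans_eq ?_
  have : frobSq (1 : Matrix q q ℂ) = Fintype.card q := by
    simp [frobSq, one_apply, apply_ite (fun z : ℂ => ‖z‖ ^ 2)]
  rw [this, mul_comm]

variable {b e a : Type} [Fintype b] [Fintype e] [Fintype a]

/-- The sesquilinear form of an observable on the output and a copy of the input. -/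
def readout (O : Matrix (b × a) (b × a) ℂ) (X Y : Matrix (b × e) a ℂ) : ℂ :=
  ((reshape X)ᴴ * (O * reshape Y)).trace

/-- Cauchy–Schwarz for the Frobenius inner product. The factor `|a|` cancels later against the
normalization of the maximally entangled input. -/
lemma norm_readout_le [DecidableEq b] [DecidableEq a] {O : Matrix (b × a) (b × a) ℂ} (hO : ‖O‖ ≤ 1) (X Y : Matrix (b × e) a ℂ) :
    ‖readout O X Y‖ ≤ Fintype.card a * ‖X‖ * ‖Y‖ := by
  have h1 := norm_trace_conjTranspose_mul_sq_le (reshape X) (O * reshape Y)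
  have h2 := frobSq_mul_le O (reshape Y)
  rw [frobSq_reshape] at h1 h2
  have h3 : frobSq (O * reshape Y) ≤ frobSq Y :=
    h2.trans (mul_le_of_le_one_left (frobSq_nonneg _) (pow_le_one₀ (norm_nonneg _) hO))
  have h4 : ‖readout O X Y‖ ^ 2 ≤ (Fintype.card a * ‖X‖ * ‖Y‖) ^ 2 := by
    calc _ ≤ frobSq X * frobSq (O * reshape Y) := h1
      _ ≤ (Fintype.card a * ‖X‖ ^ 2) * (Fintype.card a * ‖Y‖ ^ 2) := by
        gcongr
        · exact frobSq_nonneg _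
        · exact frobSq_le X
        · exact h3.trans (frobSq_le Y)
      _ = _ := by ring
  exact le_of_sq_le_sq h4 (by positivity)

end Readout

/-! ### Isometries near a given one -/

section Perturbation

open scoped Matrix.Norms.L2Operator

lemma norm_one_le (a : Type) [Fintype a] [DecidableEq a] : ‖(1 : Matrix a a ℂ)‖ ≤ 1 := by
  have h := l2_opNorm_conjTranspose_mul_self (1 : Matrix a a ℂ)
  rw [conjTranspose_one, Matrix.mul_one] at h
  by_contra! h1
  nlinarith

lemma norm_le_one_of_isometry {m a : Type} [Fintype m] [Fintype a] [DecidableEq a]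
    {V : Matrix m a ℂ} (hV : Vᴴ * V = 1) : ‖V‖ ≤ 1 := by
  have h := l2_opNorm_conjTranspose_mul_self V
  rw [hV] at h
  have := norm_one_le a
  by_contra! h1
  nlinarith

/-- A rotation of the isometry `V` towards an operator `K` whose range is orthogonal to that
of `V`. -/
lemma exists_isometry_near {m a : Type} [Fintype m] [DecidableEq m] [Fintype a] [DecidableEq a]
    {V K : Matrix m a ℂ} (hV : Vᴴ * V = 1) (hVK : Vᴴ * K = 0) {τ : ℝ} (hτ : 0 ≤ τ)
    (hτ' : τ ≤ 1 / 8) (hK : ‖K‖ ≤ τ) :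
    ∃ W : Matrix m a ℂ, Wᴴ * W = 1 ∧ ‖W - (V + (2 : ℂ) • K)‖ ≤ 8 * τ ^ 2 := by
  obtain ⟨P, hP⟩ : ∃ P : Matrix a a ℂ, P = Kᴴ * K := ⟨_, rfl⟩
  have hPpsd : P.PosSemidef := hP ▸ posSemidef_conjTranspose_mul_self K
  have hD : (1 + P).PosDef := PosDef.one.add_posSemidef hPpsd
  have hDu : IsUnit (1 + P).det := (Matrix.isUnit_iff_isUnit_det _).1 hD.isUnit
  set Q := (1 + P)⁻¹ with hQ
  have hQD : Q * (1 + P) = 1 := nonsing_inv_mul _ hDu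
  have hDQ : (1 + P) * Q = 1 := mul_nonsing_inv _ hDu
  have hPH : Pᴴ = P := hPpsd.isHermitian
  have hQH : Qᴴ = Q := by rw [hQ, conjTranspose_nonsing_inv, hD.isHermitian.eq]
  have hKV : Kᴴ * V = 0 := by
    have := congrArg conjTranspose hVK
    simpa using this
  have hPQ : P * Q = Q * P := by
    have h1 : Q + P * Q = 1 := by rw [← hDQ, Matrix.add_mul, Matrix.one_mul]
    have h2 : Q + Q * P = 1 := by rw [← hQD, Matrix.mul_add, Matrix.mul_one]
    exact add_left_cancel (h1.trans h2.symm)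
  have hQ1 : Q = 1 - P * Q := by
    rw [eq_sub_iff_add_eq, ← hDQ, Matrix.add_mul, Matrix.one_mul]
  have hPn : ‖P‖ ≤ τ ^ 2 := by
    rw [hP, l2_opNorm_conjTranspose_mul_self, ← sq]
    gcongr
  have hQn : ‖Q‖ ≤ 2 := by
    have h1 : ‖Q‖ ≤ ‖(1 : Matrix a a ℂ)‖ + ‖P * Q‖ := by
      conv_lhs => rw [hQ1]
      exact norm_sub_le _ _
    have h2 : ‖P * Q‖ ≤ 1 / 2 * ‖Q‖ :=
      (l2_opNorm_mul _ _).trans (by gcongr; nlinarith)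
    linarith [norm_one_le a]
  have hVn := norm_le_one_of_isometry hV
  rw [two_smul]
  -- The rational parametrization of a rotation, with `K` as tangent of the half angle: isometry
  -- follows from `(1 - P) ^ 2 + 4 P = (1 + P) ^ 2`. The deviation from `V + 2 K` is `-2 (V + K) P
  -- Q`, of norm at most `8 τ ^ 2`.
  refine ⟨V * ((1 - P) * Q) + (K + K) * Q, ?_, ?_⟩
  · have hA : (1 - P)ᴴ = 1 - P := by
      rw [conjTranspose_sub, conjTranspose_one, hPH]
    have h1 : (V * ((1 - P) * Q) + (K + K) * Q)ᴴ * (V * ((1 - P) * Q) + (K + K) * Q) =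
        Q * (1 - P) * (Vᴴ * V) * ((1 - P) * Q) + Q * (1 - P) * (Vᴴ * K + Vᴴ * K) * Q +
          (Q * (Kᴴ * V + Kᴴ * V) * ((1 - P) * Q) + Q * (Kᴴ * K + Kᴴ * K + (Kᴴ * K + Kᴴ * K)) * Q) := by
      simp only [conjTranspose_add, conjTranspose_mul, hA, hQH,
        Matrix.add_mul, Matrix.mul_add, Matrix.mul_assoc]
      abel
    rw [h1, hV, hVK, hKV, ← hP]
    have h3 : Q * (1 - P) * 1 * ((1 - P) * Q) + Q * (1 - P) * (0 + 0) * Q +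
        (Q * (0 + 0) * ((1 - P) * Q) + Q * (P + P + (P + P)) * Q) =
        (Q * (1 + P)) * ((1 + P) * Q) := by
      noncomm_ring
    rw [h3, hQD, hDQ, Matrix.one_mul]
  · have h1 : V * ((1 - P) * Q) + (K + K) * Q - (V + (K + K)) =
        -((2 : ℂ) • (V * (P * Q)) + (2 : ℂ) • (K * (P * Q))) := by
      have h2 : Q + P * Q = 1 := by rw [← hDQ, Matrix.add_mul, Matrix.one_mul]
      have h4 : V * ((1 - P) * Q) + (K + K) * Q - (V * (Q + P * Q) +
          (K * (Q + P * Q) + K * (Q + P * Q))) =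
          -((2 : ℂ) • (V * (P * Q)) + (2 : ℂ) • (K * (P * Q))) := by
        simp only [Matrix.mul_add, Matrix.add_mul, Matrix.sub_mul, Matrix.mul_sub, Matrix.one_mul,
          two_smul]
        abel
      rw [← h4, h2, Matrix.mul_one, Matrix.mul_one]
    have hPQn : ‖P * Q‖ ≤ 2 * τ ^ 2 :=
      (l2_opNorm_mul _ _).trans ((mul_le_mul hPn hQn (norm_nonneg _) (by positivity)).trans_eq
        (by ring))
    rw [h1, norm_neg]
    refine (norm_add_le _ _).trans ?_
    rw [norm_smul, norm_smul]
    have h5 : ‖V * (P * Q)‖ ≤ 1 * (2 * τ ^ 2) :=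
      (l2_opNorm_mul _ _).trans (mul_le_mul hVn hPQn (norm_nonneg _) zero_le_one)
    have h6 : ‖K * (P * Q)‖ ≤ 1 * (2 * τ ^ 2) :=
      (l2_opNorm_mul _ _).trans (mul_le_mul (hK.trans (by linarith)) hPQn (norm_nonneg _) zero_le_one)
    simp only [Complex.norm_ofNat]
    linarith

end Perturbation

end ChannelLearning

namespace ChannelLearning

open Matrix

open scoped Matrix.Norms.L2Operator

/-! ### First-order expansion of the readout -/

section ReadoutPerturbation

variable {b e a : Type} [Fintype b] [Fintype e] [Fintype a]

lemma readout_add_left (O : Matrix (b × a) (b × a) ℂ) (X X' Y : Matrix (b × e) a ℂ) :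
    readout O (X + X') Y = readout O X Y + readout O X' Y := by
  simp [readout, reshape_add, Matrix.add_mul]

lemma readout_add_right (O : Matrix (b × a) (b × a) ℂ) (X Y Y' : Matrix (b × e) a ℂ) :
    readout O X (Y + Y') = readout O X Y + readout O X Y' := by
  simp [readout, reshape_add, Matrix.mul_add]

lemma readout_smul_right (O : Matrix (b × a) (b × a) ℂ) (c : ℂ) (X Y : Matrix (b × e) a ℂ) :
    readout O X (c • Y) = c * readout O X Y := by
  simp [readout, reshape_smul]

lemma readout_smul_left (O : Matrix (b × a) (b × a) ℂ) (c : ℂ) (X Y : Matrix (b × e) a ℂ) :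
    readout O (c • X) Y = star c * readout O X Y := by
  simp [readout, reshape_smul]

/-- Because `O` annihilates the reshaped `V` on the right and the reshaped `K` on the left, of the
terms without the error `η` only the cross term of `V` with `2 K` survives. The terms with `η` sum
to at most `8 τ ^ 2 (1 + 2 τ + 8 τ ^ 2)` times `|a|`. -/
lemma norm_readout_perturbation_le [DecidableEq b] [DecidableEq a] {O : Matrix (b × a) (b × a) ℂ} {V K W : Matrix (b × e) a ℂ}
    {τ : ℝ} (hτ : 0 ≤ τ) (hτ' : τ ≤ 1 / 8) (hO : ‖O‖ ≤ 1) (hV : ‖V‖ ≤ 1) (hK : ‖K‖ ≤ τ)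
    (hW : ‖W - (V + (2 : ℂ) • K)‖ ≤ 8 * τ ^ 2) (hOV : O * reshape V = 0)
    (hKO : (reshape K)ᴴ * O = 0) :
    ‖readout O W W - 2 * readout O V K‖ ≤ 16 * τ ^ 2 * Fintype.card a := by
  set η := W - (V + (2 : ℂ) • K) with hη
  have hWe : W = V + (2 : ℂ) • K + η := by rw [hη]; abel
  have h1 : ∀ X : Matrix (b × e) a ℂ, readout O X V = 0 := fun X => by simp [readout, hOV]
  have h2 : ∀ Y : Matrix (b × e) a ℂ, readout O K Y = 0 := fun Y => by
    simp [readout, ← Matrix.mul_assoc, hKO]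
  have h3 : readout O W W - 2 * readout O V K =
      readout O V η + (2 * readout O η K + readout O η η) := by
    rw [hWe]
    simp only [readout_add_left, readout_add_right, readout_smul_left, readout_smul_right, h1, h2]
    ring
  rw [h3]
  have hc : (0 : ℝ) ≤ Fintype.card a := by positivity
  have h4 : ‖readout O V η‖ ≤ Fintype.card a * 1 * (8 * τ ^ 2) :=
    (norm_readout_le hO _ _).trans (by gcongr)
  have h5 : ‖readout O η K‖ ≤ Fintype.card a * (8 * τ ^ 2) * τ :=
    (norm_readout_le hO _ _).trans (by gcongr)
  have h6 : ‖readout O η η‖ ≤ Fintype.card a * (8 * τ ^ 2) * (8 * τ ^ 2) :=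
    (norm_readout_le hO _ _).trans (by gcongr)
  have h7 : ‖2 * readout O η K‖ = 2 * ‖readout O η K‖ := by simp
  refine (norm_add_le _ _).trans ((add_le_add_right (norm_add_le _ _) _).trans ?_)
  rw [h7]
  have h8 : 2 * τ + 8 * τ ^ 2 ≤ 1 := by nlinarith
  have h9 : 0 ≤ Fintype.card a * (8 * τ ^ 2) := by positivity
  nlinarith [mul_le_mul_of_nonneg_left h8 h9]

end ReadoutPerturbation

/-! ### Embedding matrices -/

section Incl

variable {p q : Type} [DecidableEq q]

/-- The 0-1 matrix of a map. -/
def incl (f : p → q) : Matrix q p ℂ := of fun x y => if x = f y then 1 else 0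

lemma incl_conjTranspose_mul [Fintype q] {p' : Type} (f : p → q) (g : p' → q) (x : p) (y : p') :
    ((incl f)ᴴ * incl g) x y = if f x = g y then 1 else 0 := by
  simp [incl, mul_apply, apply_ite (starRingEnd ℂ), eq_comm]

lemma incl_isometry [Fintype q] [DecidableEq p] {f : p → q} (hf : Function.Injective f) :
    (incl f)ᴴ * incl f = 1 := by
  ext x y
  rw [incl_conjTranspose_mul, one_apply]
  simp [hf.eq_iff]

lemma incl_orthogonal [Fintype q] {p' : Type} {f : p → q} {g : p' → q} (h : ∀ x y, f x ≠ g y) :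
    (incl f)ᴴ * incl g = 0 := by
  ext x y
  rw [incl_conjTranspose_mul, if_neg (h x y), Matrix.zero_apply]

lemma sum_incl_gram [Fintype q] [DecidableEq p] {i : Type} [Fintype i] [DecidableEq i]
    {f : i → p → q} (hf : ∀ k x l y, f k x = f l y → k = l ∧ x = y) :
    (∑ k, incl (f k))ᴴ * ∑ k, incl (f k) = (Fintype.card i : ℂ) • 1 := by
  rw [conjTranspose_sum, Matrix.sum_mul]
  simp only [Matrix.mul_sum]
  have h1 : ∀ k, ∑ l, (incl (f k))ᴴ * incl (f l) = 1 := by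
    intro k
    rw [Finset.sum_eq_single k]
    · exact incl_isometry fun x y h => (hf k x k y h).2
    · intro l _ hl
      exact incl_orthogonal fun x y h => hl (hf k x l y h).1.symm
    · simp
  rw [Finset.sum_congr rfl fun k _ => h1 k, Finset.sum_const, Finset.card_univ,
    Nat.cast_smul_eq_nsmul]

lemma norm_incl_le [Fintype p] [Fintype q] [DecidableEq p] {f : p → q}
    (hf : Function.Injective f) : ‖incl f‖ ≤ 1 :=
  norm_le_one_of_isometry (incl_isometry hf)

lemma reshape_incl_mul {b b' e e' a : Type} [Fintype b'] [Fintype e'] [Fintype a] [DecidableEq b]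
    [DecidableEq e] [DecidableEq a] (β : b' → b) (ε : e' → e) (M : Matrix (b' × e') a ℂ) :
    reshape (incl (Prod.map β ε) * M) =
      incl (Prod.map β (id : a → a)) * reshape M * (incl ε)ᴴ := by
  ext ⟨x, y⟩ z
  simp only [reshape, of_apply, mul_apply, incl, conjTranspose_apply, Fintype.sum_prod_type,
    Prod.map, Prod.mk.injEq, id, ite_and]
  rw [Finset.sum_comm]
  refine Finset.sum_congr rfl fun k _ => ?_
  rw [Finset.sum_mul]
  refine Finset.sum_congr rfl fun l _ => ?_
  by_cases h1 : x = β l <;> by_cases h2 : z = ε k <;> simp [h1, h2]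

end Incl

/-- A bound on the operator norm of a real matrix is also a bound over the complex numbers. -/
lemma OpBound.norm_le {p q : Type} [Fintype p] [Fintype q] [DecidableEq q] {M : Matrix p q ℝ}
    {c : ℝ} (hc : 0 ≤ c) (h : OpBound M c) : ‖M.map Complex.ofReal‖ ≤ c := by
  rw [l2_opNorm_def]
  refine ContinuousLinearMap.opNorm_le_bound _ hc fun z => ?_
  refine le_of_sq_le_sq ?_ (by positivity)
  rw [mul_pow, EuclideanSpace.norm_sq_eq, EuclideanSpace.norm_sq_eq]
  have h1 := h fun j => (z j).re
  have h2 := h fun j => (z j).im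
  have h3 : ∀ w : ℂ, ‖w‖ ^ 2 = w.re ^ 2 + w.im ^ 2 := fun w => by
    rw [← Complex.normSq_eq_norm_sq, Complex.normSq_apply]
    ring
  simp only [h3, Finset.sum_add_distrib, mul_add]
  refine add_le_add (le_of_eq_of_le ?_ h1) (le_of_eq_of_le ?_ h2)
  · refine Finset.sum_congr rfl fun i _ => ?_
    simp [toLpLin_apply, mulVec, dotProduct]
  · refine Finset.sum_congr rfl fun i _ => ?_
    simp [toLpLin_apply, mulVec, dotProduct]

end ChannelLearning

namespace ChannelLearning

open Matrix

open scoped Matrix.Norms.L2Operator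

/-! ### A packing of isometries -/

section Packing

set_option linter.unusedSectionVars false

variable {G H κ B₁ B E A : Type} [Fintype G] [Fintype H] [Fintype κ] [Fintype B₁] [Fintype B]
  [Fintype E] [Fintype A] [DecidableEq G] [DecidableEq H] [DecidableEq κ] [DecidableEq B₁]
  [DecidableEq B] [DecidableEq E] [DecidableEq A]

/-- The isometry `|g, k⟩ ↦ |H|^(-1/2) ∑ i, |g, i⟩ ⊗ |i, k⟩`. -/
noncomputable def baseCore (π : A ≃ G × κ) : Matrix ((G × H) × (H × κ)) A ℂ :=
  ((Real.sqrt (Fintype.card H))⁻¹ : ℂ) • ∑ i : H, incl fun a => (((π a).1, i), (i, (π a).2))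

/-- The isometry `baseCore`, with values in `B ⊗ E`. -/
noncomputable def base (β₀ : G × H → B) (ε : H × κ → E) (π : A ≃ G × κ) :
    Matrix (B × E) A ℂ :=
  incl (Prod.map β₀ ε) * baseCore (H := H) π

/-- The matrix of signs, scaled by `σ`. -/
noncomputable def signMatrix (σ : ℝ) (s : (B₁ × (H × κ)) × A → Bool) :
    Matrix (B₁ × (H × κ)) A ℂ :=
  (σ : ℂ) • (of fun i j => sgn (s (i, j))).map Complex.ofReal

/-- The perturbation of `base` that is described by an array of signs. -/
noncomputable def signPert (β₁ : B₁ → B) (ε : H × κ → E) (σ : ℝ)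
    (s : (B₁ × (H × κ)) × A → Bool) : Matrix (B × E) A ℂ :=
  incl (Prod.map β₁ ε) * signMatrix σ s

lemma sqrt_inv_smul_gram {p q : Type} [Fintype p] [DecidableEq q] {n : ℕ}
    {M : Matrix p q ℂ} {t : ℂ} (hM : Mᴴ * M = t • (1 : Matrix q q ℂ)) :
    (((Real.sqrt n)⁻¹ : ℂ) • M)ᴴ * (((Real.sqrt n)⁻¹ : ℂ) • M) =
      (t / n) • (1 : Matrix q q ℂ) := by
  have h1 : (Real.sqrt n : ℂ) * Real.sqrt n = n := by
    rw [← Complex.ofReal_mul, Real.mul_self_sqrt (Nat.cast_nonneg _), Complex.ofReal_natCast]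
  rw [conjTranspose_smul, Matrix.smul_mul, Matrix.mul_smul, hM, smul_smul, smul_smul]
  congr 1
  rw [star_inv₀, RCLike.star_def, Complex.conj_ofReal, ← mul_inv, h1]
  ring

lemma baseCore_isometry [Nonempty H] (π : A ≃ G × κ) :
    (baseCore (H := H) π)ᴴ * baseCore (H := H) π = 1 := by
  rw [baseCore, sqrt_inv_smul_gram (sum_incl_gram ?_), div_self (by simp), one_smul]
  intro k x l y h
  simp only [Prod.mk.injEq] at h
  exact ⟨h.1.2, π.injective (Prod.ext h.1.1 h.2.2)⟩

lemma reshape_baseCore (π : A ≃ G × κ) :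
    reshape (baseCore (H := H) π) = ((Real.sqrt (Fintype.card H))⁻¹ : ℂ) •
      ∑ g : G, incl fun x : H × κ => ((g, x.1), π.symm (g, x.2)) := by
  rw [baseCore, reshape_smul]
  congr 1
  ext ⟨⟨g, i⟩, a⟩ ⟨j, k⟩
  simp only [reshape, of_apply, Matrix.sum_apply, incl, Prod.mk.injEq, Equiv.eq_symm_apply,
    Prod.ext_iff (x := π a)]
  rw [Finset.sum_eq_single i (by intro x _ hx; rw [if_neg]; grind) (by simp),
    Finset.sum_eq_single g (by intro x _ hx; rw [if_neg]; grind) (by simp)]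
  congr 1
  grind

/-- With environment and input exchanged, `baseCore` is again a sum of embeddings with orthogonal
ranges, now indexed by `G` instead of `H`. -/
lemma reshape_baseCore_gram (π : A ≃ G × κ) :
    (reshape (baseCore (H := H) π))ᴴ * reshape (baseCore (H := H) π) =
      ((Fintype.card G : ℂ) / Fintype.card H) • (1 : Matrix (H × κ) (H × κ) ℂ) := by
  rw [reshape_baseCore, sqrt_inv_smul_gram (sum_incl_gram ?_)]
  intro k x l y h
  simp only [Prod.mk.injEq, π.symm.injective.eq_iff] at h
  exact ⟨h.1.1, Prod.ext h.1.2 h.2.2⟩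

variable {β₀ : G × H → B} {β₁ : B₁ → B} {ε : H × κ → E} {π : A ≃ G × κ}

lemma base_isometry [Nonempty H] (hβ : Function.Injective β₀) (hε : Function.Injective ε) :
    (base β₀ ε π)ᴴ * base β₀ ε π = 1 := by
  have h := incl_isometry (hβ.prodMap hε)
  rw [base, conjTranspose_mul, Matrix.mul_assoc, ← Matrix.mul_assoc _ (incl _), h, Matrix.one_mul,
    baseCore_isometry]

lemma base_orthogonal (hβ : ∀ x y, β₀ x ≠ β₁ y) (σ : ℝ) (s : (B₁ × (H × κ)) × A → Bool) :
    (base β₀ ε π)ᴴ * signPert β₁ ε σ s = 0 := by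
  have h : (incl (Prod.map β₀ ε))ᴴ * incl (Prod.map β₁ ε) = 0 :=
    incl_orthogonal fun x y hxy => hβ _ _ (Prod.ext_iff.1 hxy).1
  rw [base, signPert, conjTranspose_mul, Matrix.mul_assoc, ← Matrix.mul_assoc _ (incl _), h,
    Matrix.zero_mul, Matrix.mul_zero]

/-- Base and perturbation use disjoint sets of output levels, and the output index stays a row index
under `reshape`. So the orthogonality holds in both shapes. -/
lemma reshape_orthogonal (hβ : ∀ x y, β₀ x ≠ β₁ y) (σ : ℝ) (s : (B₁ × (H × κ)) × A → Bool) :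
    (reshape (signPert β₁ ε σ s))ᴴ * reshape (base β₀ ε π) = 0 := by
  have h : (incl (Prod.map β₁ (id : A → A)))ᴴ *
      incl (Prod.map β₀ (id : A → A)) = 0 :=
    incl_orthogonal fun x y hxy => hβ _ _ (Prod.ext_iff.1 hxy).1.symm
  rw [base, signPert, reshape_incl_mul, reshape_incl_mul, conjTranspose_mul, conjTranspose_mul,
    Matrix.mul_assoc, Matrix.mul_assoc, Matrix.mul_assoc, ← Matrix.mul_assoc _ (incl _), h,
    Matrix.zero_mul, Matrix.mul_zero, Matrix.mul_zero]

lemma reshape_base_gram (hβ : Function.Injective β₀) :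
    (reshape (base β₀ ε π))ᴴ * reshape (base β₀ ε π) =
      ((Fintype.card G : ℂ) / Fintype.card H) • (incl ε * (incl ε)ᴴ) := by
  have h : (incl (Prod.map β₀ (id : A → A)))ᴴ *
      incl (Prod.map β₀ (id : A → A)) = 1 :=
    incl_isometry (hβ.prodMap Function.injective_id)
  rw [base, reshape_incl_mul, conjTranspose_mul, conjTranspose_mul, conjTranspose_conjTranspose,
    Matrix.mul_assoc, Matrix.mul_assoc, Matrix.mul_assoc, ← Matrix.mul_assoc _ (incl _), h,
    Matrix.one_mul, ← Matrix.mul_assoc (reshape _)ᴴ, reshape_baseCore_gram, Matrix.smul_mul,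
    Matrix.one_mul, Matrix.mul_smul]

lemma norm_reshape_base_sq_le (hβ : Function.Injective β₀) (hε : Function.Injective ε) :
    ‖reshape (base β₀ ε π)‖ ^ 2 ≤ (Fintype.card G : ℝ) / Fintype.card H := by
  rw [sq, ← l2_opNorm_conjTranspose_mul_self, reshape_base_gram hβ, norm_smul]
  have h1 : ‖incl ε * (incl ε)ᴴ‖ ≤ 1 := by
    refine (l2_opNorm_mul _ _).trans ?_
    rw [l2_opNorm_conjTranspose]
    exact mul_le_one₀ (norm_incl_le hε) (norm_nonneg _) (norm_incl_le hε)
  have h2 : ‖(Fintype.card G : ℂ) / Fintype.card H‖ = (Fintype.card G : ℝ) / Fintype.card H := by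
    simp
  rw [h2]
  exact mul_le_of_le_one_right (by positivity) h1

lemma norm_signPert_le (hβ : Function.Injective β₁) (hε : Function.Injective ε) {σ w : ℝ}
    (hσ : 0 ≤ σ) (hw : 0 ≤ w) {s : (B₁ × (H × κ)) × A → Bool}
    (hs : OpBound (Matrix.of fun i j => sgn (s (i, j))) w) :
    ‖signPert β₁ ε σ s‖ ≤ σ * w := by
  refine (l2_opNorm_mul _ _).trans ?_
  have h1 := norm_incl_le (hβ.prodMap hε)
  have h2 : ‖signMatrix σ s‖ ≤ σ * w := by
    rw [signMatrix, norm_smul, Complex.norm_real, Real.norm_of_nonneg hσ]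
    exact mul_le_mul_of_nonneg_left (hs.norm_le hw) hσ
  exact (mul_le_of_le_one_left (norm_nonneg _) h1).trans h2

lemma norm_reshape_signPert_le (hβ : Function.Injective β₁) (hε : Function.Injective ε) {σ w : ℝ}
    (hσ : 0 ≤ σ) (hw : 0 ≤ w) {s : (B₁ × (H × κ)) × A → Bool}
    (hs : OpBound (Matrix.of fun (i : B₁ × A) (j : H × κ) => sgn (s ((i.1, j), i.2))) w) :
    ‖reshape (signPert β₁ ε σ s)‖ ≤ σ * w := by
  rw [signPert, reshape_incl_mul]
  have h1 := norm_incl_le (hβ.prodMap (Function.injective_id (α := A)))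
  have h2 := norm_incl_le hε
  have h3 : ‖reshape (signMatrix σ s)‖ ≤ σ * w := by
    rw [signMatrix, reshape_smul, norm_smul, Complex.norm_real, Real.norm_of_nonneg hσ]
    exact mul_le_mul_of_nonneg_left (hs.norm_le hw) hσ
  rw [← l2_opNorm_conjTranspose] at h2
  have h4 : ‖incl (Prod.map β₁ (id : A → A)) * reshape (signMatrix σ s)‖ ≤ σ * w :=
    (l2_opNorm_mul _ _).trans ((mul_le_of_le_one_left (norm_nonneg _) h1).trans h3)
  exact (l2_opNorm_mul _ _).trans ((mul_le_of_le_one_right (norm_nonneg _) h2).trans h4)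

lemma frobSq_signMatrix_sub (σ : ℝ) (s s' : (B₁ × (H × κ)) × A → Bool) :
    frobSq (signMatrix σ s - signMatrix σ s') = σ ^ 2 * ∑ i, (sgn (s i) - sgn (s' i)) ^ 2 := by
  have h : ∀ i j, ‖(signMatrix σ s - signMatrix σ s') i j‖ ^ 2 =
      σ ^ 2 * (sgn (s (i, j)) - sgn (s' (i, j))) ^ 2 := by
    intro i j
    have h1 : (signMatrix σ s - signMatrix σ s') i j =
        ((σ * (sgn (s (i, j)) - sgn (s' (i, j))) : ℝ) : ℂ) := by
      simp [signMatrix, mul_sub]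
    rw [h1, Complex.norm_real, Real.norm_eq_abs, sq_abs, mul_pow]
  simp only [frobSq, h, ← Finset.mul_sum, Fintype.sum_prod_type]

/-- The form `(V, Δ) ↦ Tr (V† V Δ† Δ)` of `base` and a difference of perturbations. -/
lemma trace_base_signPert (hβ : Function.Injective β₀) (hβ' : Function.Injective β₁) (hε : Function.Injective ε) (σ : ℝ)
    (s s' : (B₁ × (H × κ)) × A → Bool) :
    ((reshape (base β₀ ε π))ᴴ * (reshape (base β₀ ε π) *
      (reshape (signPert β₁ ε σ s - signPert β₁ ε σ s'))ᴴ *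
        reshape (signPert β₁ ε σ s - signPert β₁ ε σ s'))).trace =
      ((Fintype.card G : ℝ) / Fintype.card H *
        (σ ^ 2 * ∑ i, (sgn (s i) - sgn (s' i)) ^ 2) : ℝ) := by
  have hD : reshape (signPert β₁ ε σ s - signPert β₁ ε σ s') =
      incl (Prod.map β₁ (id : A → A)) * reshape (signMatrix σ s - signMatrix σ s') *
        (incl ε)ᴴ := by
    rw [signPert, signPert, ← Matrix.mul_sub, reshape_incl_mul]
  set D := reshape (signMatrix σ s - signMatrix σ s') with hDdef
  have h1 := incl_isometry (hβ'.prodMap (Function.injective_id (α := A)))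
  have h2 := incl_isometry hε
  have h3 : (reshape (signPert β₁ ε σ s - signPert β₁ ε σ s'))ᴴ *
      reshape (signPert β₁ ε σ s - signPert β₁ ε σ s') = incl ε * (Dᴴ * D) * (incl ε)ᴴ := by
    rw [hD]
    simp only [conjTranspose_mul, conjTranspose_conjTranspose, Matrix.mul_assoc]
    rw [← Matrix.mul_assoc _ (incl (Prod.map _ _)), h1, Matrix.one_mul]
  rw [Matrix.mul_assoc (reshape (base β₀ ε π)), h3, ← Matrix.mul_assoc, reshape_base_gram hβ,
    Matrix.smul_mul, trace_smul]
  have h4 : incl ε * (incl ε)ᴴ * (incl ε * (Dᴴ * D) * (incl ε)ᴴ) =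
      incl ε * (Dᴴ * D * (incl ε)ᴴ) := by
    simp only [Matrix.mul_assoc]
    rw [← Matrix.mul_assoc _ (incl ε), h2, Matrix.one_mul]
  rw [h4, trace_mul_comm, Matrix.mul_assoc, h2, Matrix.mul_one, trace_conjTranspose_mul_self,
    hDdef, frobSq_reshape, frobSq_signMatrix_sub]
  push_cast
  rfl

end Packing

end ChannelLearning

namespace ChannelLearning

open Matrix

open scoped Matrix.Norms.L2Operator

/-! ### Separation of the perturbed channels -/

section Separation

variable {G H κ B₁ B E A : Type} [Fintype G] [Fintype H] [Fintype κ] [Fintype B₁] [Fintype B]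
  [Fintype E] [Fintype A] [DecidableEq G] [DecidableEq H] [DecidableEq κ] [DecidableEq B₁]
  [DecidableEq B] [DecidableEq E] [DecidableEq A]
  {β₀ : G × H → B} {β₁ : B₁ → B} {ε : H × κ → E} {π : A ≃ G × κ}

/-- An observable that distinguishes two perturbations of `base` to first order. -/
lemma exists_observable [Nonempty G] [Nonempty H] [Nonempty κ] [Nonempty B₁]
    (hβ₀ : Function.Injective β₀) (hβ₁ : Function.Injective β₁) (hβ : ∀ x y, β₀ x ≠ β₁ y)
    (hε : Function.Injective ε) {τ σ : ℝ} (hτ : 0 < τ)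
    (hσ : σ = τ / (16 * Real.sqrt (Fintype.card B₁ * Fintype.card (H × κ))))
    {s s' : (B₁ × (H × κ)) × A → Bool}
    (hs : OpBound (Matrix.of fun (i : B₁ × A) (j : H × κ) => sgn (s ((i.1, j), i.2)))
      (16 * Real.sqrt (Fintype.card B₁ * Fintype.card A)))
    (hs' : OpBound (Matrix.of fun (i : B₁ × A) (j : H × κ) => sgn (s' ((i.1, j), i.2)))
      (16 * Real.sqrt (Fintype.card B₁ * Fintype.card A)))
    (hsep : (Fintype.card B₁ * Fintype.card (H × κ) * Fintype.card A : ℝ) / 2 ≤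
      ∑ i, (sgn (s i) - sgn (s' i)) ^ 2) :
    ∃ O : Matrix (B × A) (B × A) ℂ, ‖O‖ ≤ 1 ∧ O * reshape (base β₀ ε π) = 0 ∧
      (∀ s'' : (B₁ × (H × κ)) × A → Bool, (reshape (signPert β₁ ε σ s''))ᴴ * O = 0) ∧
      τ * Fintype.card A / 1024 ≤ ‖readout O (base β₀ ε π) (signPert β₁ ε σ s) -
        readout O (base β₀ ε π) (signPert β₁ ε σ s')‖ := by
  have hg : (0 : ℝ) < Fintype.card G := by exact_mod_cast Fintype.card_pos
  have hh : (0 : ℝ) < Fintype.card H := by exact_mod_cast Fintype.card_pos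
  have hk : (0 : ℝ) < Fintype.card κ := by exact_mod_cast Fintype.card_pos
  have hb : (0 : ℝ) < Fintype.card B₁ := by exact_mod_cast Fintype.card_pos
  have hA : (Fintype.card A : ℝ) = Fintype.card G * Fintype.card κ := by
    rw [Fintype.card_congr π, Fintype.card_prod, Nat.cast_mul]
  have hE : (Fintype.card (H × κ) : ℝ) = Fintype.card H * Fintype.card κ := by
    rw [Fintype.card_prod, Nat.cast_mul]
  set g : ℝ := (Fintype.card G : ℝ) with hgdef
  set h : ℝ := (Fintype.card H : ℝ) with hhdef
  set k : ℝ := (Fintype.card κ : ℝ) with hkdef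
  set b : ℝ := (Fintype.card B₁ : ℝ) with hbdef
  rw [hE] at hσ hsep
  rw [hA] at hs hs' hsep ⊢
  set x := Real.sqrt (b * (h * k)) with hx
  set y := Real.sqrt (b * (g * k)) with hy
  have hx0 : 0 < x := Real.sqrt_pos.2 (by positivity)
  have hy0 : 0 < y := Real.sqrt_pos.2 (by positivity)
  have hx2 : x ^ 2 = b * (h * k) := Real.sq_sqrt (by positivity)
  have hy2 : y ^ 2 = b * (g * k) := Real.sq_sqrt (by positivity)
  have hσ0 : 0 < σ := by rw [hσ]; positivity
  set V := base β₀ ε π with hV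
  set K := signPert β₁ ε σ s with hK
  set K' := signPert β₁ ε σ s' with hK'
  -- The reshaped `V` has norm at most `√(g / h)` and the reshaped `K - K'` at most `2 τ √(g / h)`,
  -- so this `c` normalizes the observable `c V (K - K')†`. It need not be Hermitian.
  set c : ℝ := h / (2 * g * τ) with hc
  have hc0 : 0 < c := by positivity
  have horth := fun s'' => reshape_orthogonal (ε := ε) (π := π) hβ σ s''
  have horth' : ∀ s'' : (B₁ × (H × κ)) × A → Bool,
      (reshape (signPert β₁ ε σ s''))ᴴ * reshape V = 0 := horth
  have hΔV : (reshape (K - K'))ᴴ * reshape V = 0 := by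
    rw [reshape_sub, conjTranspose_sub, Matrix.sub_mul, horth', horth', sub_zero]
  refine ⟨(c : ℂ) • (reshape V * (reshape (K - K'))ᴴ), ?_, ?_, ?_, ?_⟩
  · have h1 : ‖reshape V‖ ≤ y / x := by
      refine le_of_sq_le_sq ?_ (by positivity)
      refine (norm_reshape_base_sq_le hβ₀ hε).trans_eq ?_
      rw [div_pow, hx2, hy2, ← hgdef, ← hhdef]
      field_simp
    have h2 : ‖reshape (K - K')‖ ≤ 2 * (σ * (16 * y)) := by
      rw [reshape_sub]
      refine (norm_sub_le _ _).trans ?_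
      have h3 := norm_reshape_signPert_le hβ₁ hε hσ0.le (by positivity) hs
      have h4 := norm_reshape_signPert_le hβ₁ hε hσ0.le (by positivity) hs'
      linarith
    rw [norm_smul, Complex.norm_real, Real.norm_of_nonneg hc0.le]
    have h3 : ‖reshape V * (reshape (K - K'))ᴴ‖ ≤ y / x * (2 * (σ * (16 * y))) := by
      refine (l2_opNorm_mul _ _).trans ?_
      rw [l2_opNorm_conjTranspose]
      gcongr
    refine (mul_le_mul_of_nonneg_left h3 hc0.le).trans_eq ?_
    have h4 : c * (y / x * (2 * (σ * (16 * y)))) = h * y ^ 2 / (g * x ^ 2) := by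
      rw [hc, hσ]
      field_simp
    rw [h4, hx2, hy2]
    field_simp
  · rw [Matrix.smul_mul, Matrix.mul_assoc, hΔV, Matrix.mul_zero, smul_zero]
  · intro s''
    rw [Matrix.mul_smul, ← Matrix.mul_assoc, horth', Matrix.zero_mul, smul_zero]
  · have h1 : ∀ O, readout O V K - readout O V K' = readout O V (K - K') := by
      intro O
      simp [readout, reshape_sub, Matrix.mul_sub]
    rw [h1, readout, Matrix.smul_mul, Matrix.mul_smul, trace_smul,
      trace_base_signPert hβ₀ hβ₁ hε, norm_smul, Complex.norm_real, Complex.norm_real,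
      Real.norm_of_nonneg hc0.le, Real.norm_of_nonneg (by positivity), ← hgdef, ← hhdef]
    -- The signal is `c (g / h)` times the squared Frobenius norm of `K - K'`. One power of `τ` in
    -- `σ ^ 2` cancels against `c`, and this leaves a first-order effect.
    have h2 : c * (g / h * (σ ^ 2 * (b * (h * k) * (g * k) / 2))) = τ * (g * k) / 1024 := by
      have h3 : σ ^ 2 = τ ^ 2 / (256 * (b * (h * k))) := by
        rw [hσ, div_pow, mul_pow, hx2]
        norm_num
      rw [h3, hc]
      field_simp
      norm_num
    rw [← h2]
    gcongr

end Separation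

/-- A large packing of the channels with given dimensions and Choi rank. -/
lemma exists_channel_packing {dA dB r g h k b : ℕ} (hg : 0 < g) (hh : 0 < h) (hk : 0 < k)
    (hb : 0 < b) (hB : g * h + b ≤ dB) (hA : g * k ≤ dA) (hr : h * k ≤ r) (hAB : dA ≤ r * dB)
    (hgb : g ≤ b * h) (hhb : h ≤ b * g) :
    ∃ (X : Type) (_ : Fintype X) (Φ : X → SuperOp (Fin dA) (Fin dB)),
      Real.exp (((b * (h * k) * (g * k) : ℕ) : ℝ) / 8) ≤ Fintype.card X ∧
      (∀ x, IsChannel (Φ x)) ∧ (∀ x, choiRank (Φ x) ≤ r) ∧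
      ∀ x y, x ≠ y → ∀ ε : ℝ, 0 ≤ ε → ε ≤ 8 * (1 / 2 ^ 15) ^ 2 → ∀ Ψ,
        ¬(diamondNorm (Ψ - Φ x) ≤ ENNReal.ofReal ε ∧
          diamondNorm (Ψ - Φ y) ≤ ENNReal.ofReal ε) := by
  have : NeZero g := ⟨hg.ne'⟩
  have : NeZero h := ⟨hh.ne'⟩
  have : NeZero k := ⟨hk.ne'⟩
  have : NeZero b := ⟨hb.ne'⟩
  have hgk : 0 < g * k := Nat.mul_pos hg hk
  have : NeZero (g * k) := ⟨hgk.ne'⟩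
  -- With this value the signal `2 τ / 1024` equals `64 τ ^ 2`. The second-order errors of two
  -- channels take `32 τ ^ 2`, and what remains exceeds `2 ε ≤ 16 τ ^ 2`.
  obtain ⟨τ, hτ⟩ : ∃ τ : ℝ, τ = 1 / 2 ^ 15 := ⟨_, rfl⟩
  rw [← hτ]
  have hτ0 : 0 < τ := by rw [hτ]; positivity
  have hτ8 : τ ≤ 1 / 8 := by rw [hτ]; norm_num
  obtain ⟨T, hTcard, hT1, hT2, hTsep⟩ := exists_sign_packing (Fin b) (Fin h × Fin k) (Fin (g * k))
    (by simp only [Fintype.card_fin, Fintype.card_prod]; nlinarith)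
    (by simp only [Fintype.card_fin, Fintype.card_prod]; nlinarith)
  let π : Fin (g * k) ≃ Fin g × Fin k := finProdFinEquiv.symm
  obtain ⟨βe⟩ : Nonempty ((Fin g × Fin h) ⊕ Fin b ↪ Fin dB) :=
    Function.Embedding.nonempty_of_card_le (by simpa using hB)
  obtain ⟨εe⟩ : Nonempty (Fin h × Fin k ↪ Fin r) :=
    Function.Embedding.nonempty_of_card_le (by simpa using hr)
  let f : Fin (g * k) ↪ Fin dA := Fin.castLEEmb hA
  let β₀ : Fin g × Fin h → Fin dB := fun x => βe (Sum.inl x)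
  let β₁ : Fin b → Fin dB := fun x => βe (Sum.inr x)
  have hβ₀ : Function.Injective β₀ := βe.injective.comp Sum.inl_injective
  have hβ₁ : Function.Injective β₁ := βe.injective.comp Sum.inr_injective
  have hβ : ∀ x y, β₀ x ≠ β₁ y := fun x y hxy => by simpa using βe.injective hxy
  set σ : ℝ := τ / (16 * Real.sqrt (Fintype.card (Fin b) * Fintype.card (Fin h × Fin k))) with hσ
  have hbhk : (0 : ℝ) < Fintype.card (Fin b) * Fintype.card (Fin h × Fin k) := by
    have h1 : 0 < Fintype.card (Fin b) := Fintype.card_pos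
    have h2 : 0 < Fintype.card (Fin h × Fin k) := Fintype.card_pos
    positivity
  have hσ0 : 0 ≤ σ := by positivity
  let V := base β₀ εe π
  have hV : Vᴴ * V = 1 := base_isometry hβ₀ εe.injective
  let K := fun s => signPert (A := Fin (g * k)) β₁ εe σ s
  have hK : ∀ s ∈ T, ‖K s‖ ≤ τ := by
    intro s hs
    refine (norm_signPert_le hβ₁ εe.injective hσ0 (by positivity) (hT1 s hs)).trans_eq ?_
    rw [hσ]
    have := Real.sqrt_pos.2 hbhk
    field_simp
  have hW : ∀ s : T, ∃ W : Matrix (Fin dB × Fin r) (Fin (g * k)) ℂ, Wᴴ * W = 1 ∧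
      ‖W - (V + (2 : ℂ) • K s)‖ ≤ 8 * τ ^ 2 := fun s =>
    exists_isometry_near hV (base_orthogonal hβ σ s.1) hτ0.le hτ8 (hK s s.2)
  choose W hWiso hWnear using hW
  have hU : ∀ s : T, ∃ U : Matrix (Fin dB × Fin r) (Fin dA) ℂ, Uᴴ * U = 1 ∧
      ∀ i x, U i (f x) = W s i x := fun s =>
    exists_isometry_extension (by simpa [mul_comm] using hAB) f (hWiso s)
  choose U hUiso hUext using hU
  refine ⟨T, inferInstance, fun s => stinespring (U s), ?_, fun s => isChannel_stinespring (hUiso s),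
    fun s => ?_, ?_⟩
  · rw [Fintype.card_coe]
    refine le_trans (le_of_eq ?_) hTcard
    simp
  · simpa using choiRank_stinespring_le (U s)
  intro s s' hne ε hε0 hε Ψ
  obtain ⟨O, hO, hOV, hKO, hsep⟩ := exists_observable (π := π) hβ₀ hβ₁ hβ εe.injective hτ0 hσ
    (hT2 s s.2) (hT2 s' s'.2) (hTsep s s.2 s' s'.2 fun h => hne (Subtype.ext h))
  have hα : (0 : ℝ) < ((g * k : ℕ) : ℝ) := by exact_mod_cast hgk
  have hread : ∀ s : T, ‖readout O (W s) (W s) - 2 * readout O V (K s)‖ ≤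
      16 * τ ^ 2 * ((g * k : ℕ) : ℝ) := by
    intro s
    have := norm_readout_perturbation_le hτ0.le hτ8 hO (norm_le_one_of_isometry hV) (hK s s.2)
      (hWnear s) hOV (hKO s)
    rwa [Fintype.card_fin] at this
  let N : ℂ := ((Real.sqrt ((g * k : ℕ) : ℝ))⁻¹ : ℝ)
  have hN : N * star N = ((((g * k : ℕ) : ℝ)⁻¹ : ℝ) : ℂ) := by
    rw [RCLike.star_def, Complex.conj_ofReal, ← Complex.ofReal_mul, ← mul_inv,
      Real.mul_self_sqrt hα.le]
  -- The maximally entangled state between the used inputs and a reference; the extension `U` acts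
  -- on it only through `W`.
  let ψ : Fin dA × Fin (g * k) → ℂ := fun x => if x.1 = f x.2 then N else 0
  have hψ : star ψ ⬝ᵥ ψ = 1 := by
    have h1 : ∀ (x : Fin dA) (y : Fin (g * k)), star (ψ (x, y)) * ψ (x, y) =
        if x = f y then N * star N else 0 := by
      intro x y
      simp only [ψ]
      split_ifs <;> simp [mul_comm]
    simp only [dotProduct, Pi.star_apply, Fintype.sum_prod_type_right, h1, Finset.sum_ite_eq',
      Finset.mem_univ, if_true, Finset.sum_const, Finset.card_univ, Fintype.card_fin, hN]
    rw [nsmul_eq_mul, ← Complex.ofReal_natCast, ← Complex.ofReal_mul, mul_inv_cancel₀ hα.ne',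
      Complex.ofReal_one]
  have hampl : ∀ s : T, ampliate (stinespring (U s)) (g * k) (vecMulVec ψ (star ψ)) =
      (N * star N) • (reshape (W s) * (reshape (W s))ᴴ) := by
    intro s
    ext ⟨p, x⟩ ⟨q, y⟩
    have h1 : (of fun i j => vecMulVec ψ (star ψ) (i, x) (j, y)) =
        vecMulVec (Pi.single (f x) N) (star (Pi.single (f y) N)) := by
      ext i j
      by_cases hi : i = f x <;> by_cases hj : j = f y <;> simp [vecMulVec_apply, ψ, hi, hj]
    simp only [ampliate, of_apply]
    rw [h1, stinespring_vecMulVec]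
    simp only [mulVec_single, Matrix.smul_apply, mul_apply, conjTranspose_apply, reshape, of_apply,
      smul_eq_mul, Finset.mul_sum, Pi.smul_apply, MulOpposite.smul_eq_mul_unop,
      MulOpposite.unop_op, col_apply, hUext, star_mul']
    exact Finset.sum_congr rfl fun z _ => by ring
  have htr : ∀ s : T, (O * ampliate (stinespring (U s)) (g * k) (vecMulVec ψ (star ψ))).trace =
      (N * star N) * readout O (W s) (W s) := by
    intro s
    rw [hampl, Matrix.mul_smul, trace_smul, smul_eq_mul, readout, ← Matrix.mul_assoc,
      trace_mul_comm]
  refine not_diamondNorm_le_and_le hε0 (traceNorm_vecMulVec hψ).le hO ?_ Ψ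
  rw [htr, htr, ← mul_sub, norm_mul, hN, Complex.norm_real, Real.norm_of_nonneg (by positivity)]
  have h1 := hread s
  have h2 := hread s'
  have h3 : 2 * (readout O V (K s) - readout O V (K s')) =
      (readout O (W s) (W s) - readout O (W s') (W s')) -
      ((readout O (W s) (W s) - 2 * readout O V (K s)) -
        (readout O (W s') (W s') - 2 * readout O V (K s'))) := by ring
  have h4 : 2 * (τ * ((g * k : ℕ) : ℝ) / 1024) ≤
      ‖readout O (W s) (W s) - readout O (W s') (W s')‖ + (16 * τ ^ 2 * ((g * k : ℕ) : ℝ) +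
        16 * τ ^ 2 * ((g * k : ℕ) : ℝ)) := by
    rw [Fintype.card_fin] at hsep
    calc _ ≤ ‖2 * (readout O V (K s) - readout O V (K s'))‖ := by
          rw [norm_mul, Complex.norm_ofNat]
          gcongr
      _ ≤ _ := by
          rw [h3]
          refine (norm_sub_le _ _).trans ?_
          gcongr
          exact (norm_sub_le _ _).trans (by gcongr)
  rw [inv_mul_eq_div, lt_div_iff₀ hα]
  have h5 : 2 * (τ * ((g * k : ℕ) : ℝ) / 1024) = 64 * τ ^ 2 * ((g * k : ℕ) : ℝ) := by
    rw [hτ]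
    ring
  have h6 : 2 * ε * ((g * k : ℕ) : ℝ) ≤ 2 * (8 * τ ^ 2) * ((g * k : ℕ) : ℝ) := by gcongr
  have h7 : 0 < τ ^ 2 * ((g * k : ℕ) : ℝ) := by positivity
  linarith

end ChannelLearning

/-! ### Choice of dimensions and the final count -/

namespace ChannelLearning

lemma exists_packing_parameters {dA dB r : ℕ} (hA : 1 ≤ dA) (hB : 2 ≤ dB) (hAB : dA ≤ r * dB)
    (hr : r ≤ dA * dB) :
    ∃ g h k b : ℕ, 0 < g ∧ 0 < h ∧ 0 < k ∧ 0 < b ∧ g * h + b ≤ dB ∧ g * k ≤ dA ∧ h * k ≤ r ∧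
      g ≤ b * h ∧ h ≤ b * g ∧ r * dA * dB ≤ 9 * (b * (h * k) * (g * k)) := by
  have hr0 : 0 < r := by
    rcases Nat.eq_zero_or_pos r with rfl | h
    · omega
    · exact h
  obtain ⟨b, hb⟩ : ∃ b, b = dB / 2 := ⟨_, rfl⟩
  have hb0 : 0 < b := by omega
  have hb2 : 2 * b ≤ dB := by omega
  have hb3 : dB ≤ 3 * b := by omega
  -- Truncating the quotient `q / p` at `b` keeps the product with `p` within a factor 3 of `q`. The
  -- other factor 3 in the final 9 comes from `dB ≤ 3 * b`.
  have key : ∀ p q : ℕ, 0 < p → p ≤ q → q ≤ p * dB →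
      -- The larger of `r` and `dA` plays the role of `q`. The factor `g` or `h` that belongs to the
      -- smaller one is set to 1.
      0 < min (q / p) b ∧ min (q / p) b * p ≤ q ∧ q ≤ 3 * (min (q / p) b * p) := by
    intro p q hp hpq hq
    have h1 : 0 < q / p := Nat.div_pos hpq hp
    refine ⟨lt_min h1 hb0,
      (Nat.mul_le_mul_right p (min_le_left _ _)).trans (Nat.div_mul_le_self q p), ?_⟩
    rcases min_choice (q / p) b with h | h <;> rw [h]
    · have h2 := Nat.div_add_mod' q p
      have h3 := Nat.mod_lt q hp
      nlinarith
    · nlinarith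
  rcases le_total r dA with h | h
  · obtain ⟨h1, h2, h3⟩ := key r dA hr0 h hAB
    have h4 : min (dA / r) b ≤ b := min_le_right _ _
    refine ⟨min (dA / r) b, 1, r, b, h1, one_pos, hr0, hb0, by omega, h2, by omega, by omega,
      Nat.mul_pos hb0 h1, ?_⟩
    calc r * dA * dB ≤ r * (3 * (min (dA / r) b * r)) * (3 * b) := by gcongr
      _ = _ := by ring
  · obtain ⟨h1, h2, h3⟩ := key dA r hA h hr
    have h4 : min (r / dA) b ≤ b := min_le_right _ _
    refine ⟨1, min (r / dA) b, dA, b, one_pos, h1, hA, hb0, by omega, by omega, h2,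
      Nat.mul_pos hb0 h1, by omega, ?_⟩
    calc r * dA * dB ≤ (3 * (min (r / dA) b * dA)) * dA * (3 * b) := by gcongr
      _ = _ := by ring

/-- The term of index `n` in the binomial expansion of `(exp(-s) + 1) ^ K` is at most the whole sum.
-/
lemma choose_le_exp (K n : ℕ) (s : ℝ) :
    (K.choose n : ℝ) ≤ Real.exp (Real.exp (-s) * K + s * n) := by
  rcases lt_or_ge K n with h | h
  · rw [Nat.choose_eq_zero_of_lt h, Nat.cast_zero]
    positivity
  have h1 : Real.exp (-s) ^ n * (K.choose n : ℝ) ≤ (Real.exp (-s) + 1) ^ K := by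
    rw [add_pow]
    refine le_trans (le_of_eq ?_) (Finset.single_le_sum
      (f := fun m => Real.exp (-s) ^ m * 1 ^ (K - m) * (K.choose m : ℝ))
      (fun m _ => by positivity) (Finset.mem_range.2 (Nat.lt_succ_of_le h)))
    simp
  have h2 : (Real.exp (-s) + 1) ^ K ≤ Real.exp (Real.exp (-s) * K) := by
    rw [mul_comm, Real.exp_nat_mul]
    gcongr
    exact Real.add_one_le_exp _
  calc (K.choose n : ℝ) = Real.exp (s * n) * (Real.exp (-s) ^ n * (K.choose n : ℝ)) := by
        rw [← Real.exp_nat_mul, ← mul_assoc, ← Real.exp_add]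
        simp [mul_comm]
    _ ≤ Real.exp (s * n) * Real.exp (Real.exp (-s) * K) := by
        gcongr
        exact h1.trans h2
    _ = _ := by rw [← Real.exp_add, add_comm]

/-- Few queries to a packing of exponential size identify its members with small probability. -/
lemma le_of_choose_sq {m M n : ℕ} {N : ℝ} (hm : 0 < m) (hM : M ≤ 9 * m)
    (hN : Real.exp ((m : ℝ) / 72) ≤ N) (hN2 : 2 ≤ N)
    (h : N * (2 / 3) ≤ (((M + n - 1).choose n : ℕ) : ℝ) ^ 2) : 1 / 10000 * (m : ℝ) ≤ n := by
  by_contra! hn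
  rcases Nat.eq_zero_or_pos n with rfl | hn0
  · norm_num at h
    linarith
  have hn1 : (1 : ℝ) ≤ n := by exact_mod_cast hn0
  have hm0 : (0 : ℝ) < m := by exact_mod_cast hm
  have hK : (((M + n - 1 : ℕ)) : ℝ) ≤ 10 * m := by
    have h1 : M + n - 1 ≤ 9 * m + n := by omega
    have h2 : (((M + n - 1 : ℕ)) : ℝ) ≤ 9 * m + n := by exact_mod_cast h1
    linarith
  have h12 : Real.exp (-12) ≤ 1 / 4096 := by
    rw [Real.exp_neg, ← one_div]
    refine one_div_le_one_div_of_le (by norm_num) ?_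
    have h1 : (2 : ℝ) ≤ Real.exp 1 := by linarith [Real.add_one_le_exp 1]
    calc (4096 : ℝ) = 2 ^ 12 := by norm_num
      _ ≤ Real.exp 1 ^ 12 := by gcongr
      _ = Real.exp 12 := by rw [← Real.exp_nat_mul]; norm_num
  -- `choose_le_exp` with `s = 12`: the exponent is at most `2 (10 / 4096 + 12 / 10000) m`, well
  -- below `m / 72`.
  have h1 : (((M + n - 1).choose n : ℕ) : ℝ) ^ 2 ≤ Real.exp (0.0073 * m) := by
    calc _ ≤ Real.exp (Real.exp (-12) * ((M + n - 1 : ℕ) : ℝ) + 12 * n) ^ 2 := by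
          gcongr
          exact choose_le_exp _ _ _
      _ = Real.exp (2 * (Real.exp (-12) * ((M + n - 1 : ℕ) : ℝ) + 12 * n)) := by
          rw [← Real.exp_nat_mul, Nat.cast_ofNat]
      _ ≤ _ := by
          refine Real.exp_le_exp.2 ?_
          have h2 : Real.exp (-12) * ((M + n - 1 : ℕ) : ℝ) ≤ 1 / 4096 * (10 * m) := by gcongr
          linarith
  have h2 : Real.exp ((m : ℝ) / 72) = Real.exp (0.0073 * m) * Real.exp (m / 72 - 0.0073 * m) := by
    rw [← Real.exp_add]
    congr 1
    ring
  have h3 := Real.add_one_le_exp ((m : ℝ) / 72 - 0.0073 * m)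
  -- Since `1 ≤ n < m / 10000`, here `m > 10000`, which makes the gap between the exponents large.
  have h4 : (2 : ℝ) < Real.exp (m / 72 - 0.0073 * m) := by linarith
  have h5 : 0 < Real.exp (0.0073 * (m : ℝ)) := Real.exp_pos _
  nlinarith

end ChannelLearning

open ChannelLearning in
theorem mainTheorem3 :
    ∃ ε₀ : ℝ, 0 < ε₀ ∧ ∃ c : ℝ, 0 < c ∧
      ∀ (dA dB r n : ℕ), 1 ≤ dA → 2 ≤ dB → dA ≤ r * dB → r ≤ dA * dB →
      ∀ (Q : ChannelLearning.QueryModel dA dB) (Ω : Type*) [MeasurableSpace Ω]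
        (A : ChannelLearning.LearningAlgorithm n dA dB Ω) (ε : ℝ), 0 < ε → ε ≤ ε₀ →
        A.Learns Q r ε → c * ((r : ℝ) * (dA : ℝ) * (dB : ℝ)) ≤ (n : ℝ) := by
  refine ⟨8 * (1 / 2 ^ 15) ^ 2, by positivity, 1 / 10000, by norm_num, ?_⟩
  intro dA dB r n hA hB hAB hr Q Ω _ A ε hε0 hε hlearn
  obtain ⟨g, h, k, b, hg, hh, hk, hb, hgh, hgk, hhk, hgb, hhb, hm⟩ :=
    exists_packing_parameters hA hB hAB hr
  obtain ⟨X, _, Φ, hcard, hΦ, hrank, hsep⟩ :=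
    exists_channel_packing hg hh hk hb hgh hgk hhk hAB hgb hhb
  have hr0 : 0 < r := by
    rcases Nat.eq_zero_or_pos r with rfl | h
    · omega
    · exact h
  have hm0 : 0 < r * dA * dB := by positivity
  have hD : 2 ≤ dA * dB := by nlinarith
  have hsum := A.tester.sum_prob_le (C := fun x => Q.query (Φ x))
    (E := fun x => {ω | diamondNorm (A.estimate ω - Φ x) ≤ ENNReal.ofReal ε})
    (fun x => Q.isChannel_query (hΦ x)) (Q.linearlyPurified hA (by omega) hΦ hrank)
    (fun x => A.estimate_measurable _ _)
    (fun x y hxy => Set.disjoint_left.2 fun ω h1 h2 => hsep x y hxy ε hε0.le hε _ ⟨h1, h2⟩)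
  have hlow : (Fintype.card X : ℝ) * (2 / 3) ≤ ∑ x, A.tester.prob (Q.query (Φ x))
      {ω | diamondNorm (A.estimate ω - Φ x) ≤ ENNReal.ofReal ε} := by
    rw [← nsmul_eq_mul, ← Finset.card_univ]
    exact Finset.card_nsmul_le_sum _ _ _ fun x _ => hlearn (Φ x) (hΦ x) (hrank x)
  have hm' : ((r * dA * dB : ℕ) : ℝ) ≤ 9 * ((b * (h * k) * (g * k) : ℕ) : ℝ) := by
    exact_mod_cast hm
  have hexp : Real.exp (((r * dA * dB : ℕ) : ℝ) / 72) ≤ Fintype.card X :=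
    (Real.exp_le_exp.2 (by linarith)).trans hcard
  have hcard2 : (2 : ℝ) ≤ Fintype.card X := by
    have h1 : (1 : ℝ) < Fintype.card X := by
      refine lt_of_lt_of_le (Real.one_lt_exp_iff.2 ?_) hexp
      have : (0 : ℝ) < ((r * dA * dB : ℕ) : ℝ) := by exact_mod_cast hm0
      positivity
    exact_mod_cast h1
  -- With `D = dA * dB` the parameter count is `2 r D + 4 D + r + 5`. It is at most `9 r D` because
  -- `r ≥ 1` and `D ≥ 2`, with equality at `r = 1`, `D = 2`.
  have hfin := le_of_choose_sq hm0 (by nlinarith) hexp hcard2 (hlow.trans hsum)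
  push_cast at hfin
  exact hfin
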